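/- Let $q=2^e$ with $q\equiv 2 \pmod{10}$ and $q\neq 2$, and put $r=q+1$, $n=(q^2+1)/5$, $s=(q^2-q)/2$. Let $\alpha\in\mathbb F_{q^2}^*$ be a primitive $r$-th root of unity and let $\delta$ be a primitive $rn$-th root of unity in an extension field of $\mathbb F_{q^2}$ with $\delta^n=\alpha$. For an integer $i$ let $C_i=\{iq^{2j} \bmod rn : j\ge 0\}$ be the $q^2$-cyclotomic coset of $i$ modulo $rn$. An $\alpha$-constacyclic code $\mathcal C=\langle g\rangle\subseteq\mathbb F_{q^2}^n$, where $g\mid x^n-\alpha$ is monic, has defining set $\{i\in\{1+rj : 0\le j\le n-1\} : g(\delta^i)=0\}$ (taken modulo $rn$). Let $\lambda$ be an integer with $1\le\lambda\le (q+3)/5$ and let $$Z=\bigcup_{j=0}^{\frac{3(q-2)}{10}-1+\lambda} C_{s-rj}.$$ Then there is an $\alpha$-constacyclic code of length $n$ over $\mathbb F_{q^2}$ with defining set $Z$. Moreover $$Z\cap(-qZ)=C_{s-r\frac{3(q-2)}{10}}\cup C_{s-r\frac{q-2}{10}},$$ where the two cosets are disjoint and have two elements each. Every $\alpha$-constacyclic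 code $\mathcal C$ of length $n$ over $\mathbb F_{q^2}$ with defining set $Z$ yields an entanglement-assisted quantum MDS code with parameters $$\Bigl[\Bigl[\,n,\ n-\tfrac65(q-2)-4\lambda+4,\ \tfrac35(q-2)+2\lambda+1;\ 4\,\Bigr]\Bigr]_q .$$ In detail: these numbers are $[[n,k,d;c]]$ with $d$ the minimum distance of $\mathcal C$, $c=4=\operatorname{rank}(HH^*)$ for every $(n-\dim\mathcal C)\times n$ parity check matrix $H$ of $\mathcal C$ (where $H^*$ is the conjugate transpose for $x\mapsto x^q$), and $k=2\dim\mathcal C-n+c$; and an entanglement-assisted quantum MDS code with these parameters exists. Here an entanglement-assisted quantum code $[[n,k,d;c]]_q$ is given by an isometry $U:(\mathbb C^q)^{\otimes k}\otimes(\mathbb C^q)^{\otimes c}\to(\mathbb C^q)^{\otimes n}$. Its code space consists of the states $(U\otimes \mathrm{id})(\psi\otimes\Phi)$, where $\psi\in(\mathbb C^q)^{\otimes k}$ and $\Phi$ is the state of $c$ maximally entangled pairs of $q$-dimensional systems shared by sender and receiver. The code detects (in the sense of Knill and Laflamme) every error acting on fewer than $d$ of the $n$ transmitted qudits, and fails to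 detect some error acting on $d$ of them; the receiver's $c$ qudits are free of errors. It is MDS if $d\le (n+2)/2$ and $n+c-k=2(d-1)$. -/

import Mathlib

/-! ## Constacyclic codes -/

namespace Constacyclic

open Polynomial

/-- The `α`-constacyclic shift `(c₀, …, c_{n-1}) ↦ (α c_{n-1}, c₀, …, c_{n-2})`. -/
def shift {F : Type*} [Field F] {n : ℕ} (α : F) (c : Fin n → F) : Fin n → F :=
  fun i =>
    if i.val = 0 then α * c ⟨n - 1, by have := i.isLt; omega⟩
    else c ⟨i.val - 1, by have := i.isLt; omega⟩

/-- A linear code is `α`-constacyclic if it is closed under the `α`-constacyclic shift. -/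
def IsConstacyclic {F : Type*} [Field F] {n : ℕ} (α : F) (C : Submodule F (Fin n → F)) : Prop :=
  ∀ c ∈ C, shift α c ∈ C

/-- The polynomial `c₀ + c₁ X + ⋯ + c_{n-1} X ^ (n-1)` of a word. -/
noncomputable def wordPoly {F : Type*} [Field F] {n : ℕ} (c : Fin n → F) : F[X] :=
  ∑ i : Fin n, Polynomial.C (c i) * X ^ (i : ℕ)

/-- `g` is the monic divisor of `X ^ n - α` that generates the code `C`, regarded as an ideal of
`F[X] / (X ^ n - α)`. As `g ∣ X ^ n - α`, membership in the ideal `⟨g⟩` of the quotient is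
divisibility by `g`. -/
def IsGenerator {F : Type*} [Field F] {n : ℕ} (α : F) (g : F[X])
    (C : Submodule F (Fin n → F)) : Prop :=
  g.Monic ∧ g ∣ X ^ n - Polynomial.C α ∧ ∀ c : Fin n → F, c ∈ C ↔ g ∣ wordPoly c

/-- The defining set of `⟨g⟩`: the residues `i` modulo `r n` in `{1 + r j | 0 ≤ j ≤ n - 1}` for
which `δ ^ i` is a root of `g`. Here `δ` is a primitive `r n`-th root of unity in an extension. -/
def definingSet {F K : Type*} [Field F] [Field K] [Algebra F K] (r n : ℕ) (δ : K) (g : F[X]) :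
    Set (ZMod (r * n)) :=
  {i | (∃ j : ℕ, j < n ∧ i = 1 + (r : ZMod (r * n)) * (j : ZMod (r * n))) ∧
    aeval (δ ^ i.val) g = 0}

/-- The `q²`-cyclotomic coset of `i` modulo `N`. (Nonnegative exponents suffice: when `q` is prime
to `N`, the class of `q` has finite multiplicative order.) -/
def cyclotomicCoset (q N : ℕ) (i : ZMod N) : Set (ZMod N) :=
  {x | ∃ j : ℕ, x = i * (q : ZMod N) ^ (2 * j)}

/-- The set `-qZ` modulo `N`. -/
def negMul (q : ℕ) {N : ℕ} (Z : Set (ZMod N)) : Set (ZMod N) :=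
  (fun z => -(q : ZMod N) * z) '' Z

/-- The minimum weight of the nonzero codewords of `C` is `d`. -/
def HasMinDistance {F : Type*} [Field F] [DecidableEq F] {n : ℕ}
    (C : Submodule F (Fin n → F)) (d : ℕ) : Prop :=
  IsLeast {w : ℕ | ∃ c ∈ C, c ≠ 0 ∧ hammingNorm c = w} d

/-- `H` is a parity check matrix of `C`. -/
def IsParityCheck {F : Type*} [Field F] {m n : ℕ} (H : Matrix (Fin m) (Fin n) F)
    (C : Submodule F (Fin n → F)) : Prop :=
  ∀ c : Fin n → F, c ∈ C ↔ H.mulVec c = 0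

/-- The conjugate transpose over `𝔽_{q²}`, the conjugation being `x ↦ x ^ q`. -/
def conjTranspose {F : Type*} [Field F] (q : ℕ) {m n : ℕ} (H : Matrix (Fin m) (Fin n) F) :
    Matrix (Fin n) (Fin m) F :=
  H.transpose.map (fun x => x ^ q)

end Constacyclic

/-! ## Entanglement-assisted quantum codes -/

namespace EAQ

/-- The Hilbert space `(ℂ^q)^{⊗ n}` of `n` qudits of dimension `q`, with its standard
orthonormal basis indexed by `Fin n → Fin q`. -/
abbrev Qudits (q n : ℕ) : Type := EuclideanSpace ℂ (Fin n → Fin q)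

/-- The Hilbert space of `a + b` qudits, as the tensor product `(ℂ^q)^{⊗ a} ⊗ (ℂ^q)^{⊗ b}`. -/
abbrev BiQudits (q a b : ℕ) : Type := EuclideanSpace ℂ ((Fin a → Fin q) × (Fin b → Fin q))

/-- `c` maximally entangled pairs of qudits, `q ^ (-c/2) ∑_b |b⟩ ⊗ |b⟩`. -/
noncomputable def maxEntangled (q c : ℕ) : BiQudits q c c :=
  WithLp.toLp 2 fun p => if p.1 = p.2 then (((Real.sqrt ((q : ℝ) ^ c))⁻¹ : ℝ) : ℂ) else 0

/-- The encoded state `(U ⊗ id) (ψ ⊗ Φ)`. The sender applies the isometry `U` (an encoding unitary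
with ancillas in a fixed state) to her `k`-qudit message `ψ` and to her halves of the `c` maximally
entangled pairs `Φ`; the receiver holds the other halves, which are the last `c` qudits. -/
noncomputable def encode {q n k c : ℕ} (U : BiQudits q k c →ₗᵢ[ℂ] Qudits q n) (ψ : Qudits q k) :
    BiQudits q n c :=
  WithLp.toLp 2 fun p =>
    U (WithLp.toLp 2 fun y => ψ y.1 * maxEntangled q c (y.2, p.2)) p.1

/-- The operator `E` on `n` qudits acts only on the qudits in `T`, that is, `E = A ⊗ id` for an
arbitrary operator `A` on those qudits. -/
def SupportedOn {q n : ℕ} (E : Matrix (Fin n → Fin q) (Fin n → Fin q) ℂ) (T : Finset (Fin n)) :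
    Prop :=
  ∃ A : Matrix (T → Fin q) (T → Fin q) ℂ, ∀ x y : Fin n → Fin q,
    ((∀ i ∉ T, x i = y i) → E x y = A (fun i => x i) (fun i => y i)) ∧
    ((∃ i ∉ T, x i ≠ y i) → E x y = 0)

/-- The operator `E ⊗ id`: the error acts on the `n` transmitted qudits only, the receiver's halves
of the entangled pairs are free of errors. -/
noncomputable def applyError {q n c : ℕ} (E : Matrix (Fin n → Fin q) (Fin n → Fin q) ℂ)
    (v : BiQudits q n c) : BiQudits q n c :=
  WithLp.toLp 2 fun p => ∑ y : Fin n → Fin q, E p.1 y * v (y, p.2)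

/-- The Knill–Laflamme condition `P (E ⊗ id) P = z P` for the code space `{encode U ψ}`, whose
orthogonal projection is `P`: the code detects the error `E`. -/
def Detects {q n k c : ℕ} (U : BiQudits q k c →ₗᵢ[ℂ] Qudits q n)
    (E : Matrix (Fin n → Fin q) (Fin n → Fin q) ℂ) : Prop :=
  ∃ z : ℂ, ∀ φ ψ : Qudits q k,
    inner ℂ (encode U φ) (applyError E (encode U ψ)) = z * inner ℂ φ ψ

/-- There is an entanglement-assisted quantum code `[[n, k, d; c]]_q`: it encodes `k` qudits into
`n` qudits with the help of `c` maximally entangled pairs, and its minimum distance is exactly `d`,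
i.e. it detects every error on fewer than `d` transmitted qudits, but not every error on `d`. -/
def ExistsCode (q n k d c : ℕ) : Prop :=
  ∃ U : BiQudits q k c →ₗᵢ[ℂ] Qudits q n,
    (∀ (T : Finset (Fin n)) (E : Matrix (Fin n → Fin q) (Fin n → Fin q) ℂ),
      T.card < d → SupportedOn E T → Detects U E) ∧
    (∃ (T : Finset (Fin n)) (E : Matrix (Fin n → Fin q) (Fin n → Fin q) ℂ),
      T.card = d ∧ SupportedOn E T ∧ ¬ Detects U E)

/-- There is an entanglement-assisted quantum MDS code `[[n, k, d; c]]_q`: `d ≤ (n + 2) / 2` and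
the entanglement-assisted Singleton bound `n + c - k ≥ 2 (d - 1)` is attained. -/
def ExistsMDSCode (q n k d c : ℕ) : Prop :=
  ExistsCode q n k d c ∧ (d : ℚ) ≤ ((n : ℚ) + 2) / 2 ∧
    (n : ℚ) + (c : ℚ) - (k : ℚ) = 2 * ((d : ℚ) - 1)

end EAQ

/-! Write `q = 10b + 2`, so that `r = 10b + 3`, `n = 20b² + 8b + 1` and `s = 1 + 5br`. The
admissible exponents modulo `rn` are the points `s + rt` (`pt`) with `t` modulo `n`. Multiplication
by `q²` is the reflection `t ↦ 1 - t` (`pt_mul_sq`), so `Z` is the interval `-m ≤ t ≤ m + 1` with `m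
= 3b - 1 + λ ≤ 5b`. These are `2m + 2` consecutive exponents closed under Frobenius: a generator `g`
exists (`exists_monic_dvd`), and the BCH bound `2m + 3` is attained by the coefficient word of `g`.

A point `t'` equals `-q` times a point `t` iff `n ∣ s + qt + t'`. With `u = 2t - 1`, `u' = 2t' - 1`
this becomes a congruence `qu + u' ≡ 0` modulo `n`. Since `q² + 1 = 5n` and `n = (4b+1)² + (2b)²`,
its solutions form a rotated square lattice on which `u² + u'² = n(x² + y²)`. Size gives `x² + y² <
10`, parity makes `x` and `y` odd, so `x, y = ±1`: four solutions, forming two cosets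
(`dvd_iff_of_mem_Icc`). Passing from `H` to the Vandermonde matrix of the roots turns `H H*` into
`n` times a partial permutation matrix with four ones, of rank 4 (`rank_mul_conjTranspose`).

For the quantum code, `Fⁿ` over `𝔽₂` with the trace-Hermitian form is a symplectic space, and the
Pauli operators represent it. Let `S` be the dual of `C`, choose maximal isotropic `Q₂ ≤ C` and `Q₁
≤ S`, and let `x₀` be a common eigenvector of the operators of the Lagrangian `Q₁ + Q₂`. The
translates of `x₀` by `C / Q₂` (message) and `S / Q₁` (entangled halves) span the code, and summing
over the second index kills every error outside `C` (`IsWeylSystem.exists_code`). Errors in `C`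
outside `S` are not detected. The dual is MDS too, so the word of `g` is not in it, and the distance
is exact (`existsCode_of_hermitianDual`). -/

namespace EAQ

open Module

/-! ### Signs -/

/-- The nontrivial complex character of `ZMod 2`. -/
def sgn (x : ZMod 2) : ℂ := if x = 0 then 1 else -1

@[simp] lemma sgn_zero : sgn 0 = 1 := by simp [sgn]

lemma sgn_of_ne {x : ZMod 2} (h : x ≠ 0) : sgn x = -1 := by simp [sgn, h]

lemma sgn_add (x y : ZMod 2) : sgn (x + y) = sgn x * sgn y := by
  have key : ∀ x y : ZMod 2, (x = 0 ∧ y = 0 ∧ x + y = 0) ∨ (x = 0 ∧ y ≠ 0 ∧ x + y ≠ 0) ∨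
    (x ≠ 0 ∧ y = 0 ∧ x + y ≠ 0) ∨ (x ≠ 0 ∧ y ≠ 0 ∧ x + y = 0) := by decide
  rcases key x y with ⟨h1, h2, h3⟩ | ⟨h1, h2, h3⟩ | ⟨h1, h2, h3⟩ | ⟨h1, h2, h3⟩ <;>
    simp [sgn, h1, h2, h3]

lemma sgn_ne_zero (x : ZMod 2) : sgn x ≠ 0 := by unfold sgn; split_ifs <;> norm_num

lemma sgn_mul_self (x : ZMod 2) : sgn x * sgn x = 1 := by unfold sgn; split_ifs <;> norm_num

@[simp] lemma star_sgn (x : ZMod 2) : (starRingEnd ℂ) (sgn x) = sgn x := by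
  unfold sgn; split_ifs <;> simp

lemma sgn_sum {ι : Type*} (s : Finset ι) (f : ι → ZMod 2) :
    sgn (∑ i ∈ s, f i) = ∏ i ∈ s, sgn (f i) := by
  classical
  induction s using Finset.induction_on with
  | empty => simp
  | insert a s ha ih => rw [Finset.sum_insert ha, Finset.prod_insert ha, sgn_add, ih]

/-! ### Isotropic subspaces -/

section Isotropic

variable {V : Type*} [AddCommGroup V] [Module (ZMod 2) V]
  {ω : LinearMap.BilinForm (ZMod 2) V}

/-- A subspace `S` contains a subspace `Q` which contains the radical of `S` and equals its own
orthogonal complement within `S`. -/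
lemma exists_maximal_isotropic [Finite V] (hω : ω.IsAlt) (S : Submodule (ZMod 2) V) :
    ∃ Q : Submodule (ZMod 2) V, S ⊓ ω.orthogonal S ≤ Q ∧ Q ≤ S ∧ S ⊓ ω.orthogonal Q = Q := by
  have hrefl := hω.isRefl
  let P : Set (Submodule (ZMod 2) V) :=
    {Q | S ⊓ ω.orthogonal S ≤ Q ∧ Q ≤ S ∧ Q ≤ ω.orthogonal Q}
  have hP : P.Nonempty := ⟨S ⊓ ω.orthogonal S, le_rfl, inf_le_left,
    inf_le_right.trans (LinearMap.BilinForm.orthogonal_le inf_le_left)⟩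
  obtain ⟨Q, hQ⟩ := (Set.toFinite P).exists_maximal hP
  refine ⟨Q, hQ.prop.1, hQ.prop.2.1, le_antisymm ?_ (le_inf hQ.prop.2.1 hQ.prop.2.2)⟩
  rintro x ⟨hxS, hxQ⟩
  -- As `ω` is alternating, adjoining `x` keeps `Q` isotropic; maximality then puts `x` in `Q`.
  have hmem : Q ⊔ Submodule.span (ZMod 2) {x} ∈ P := by
    refine ⟨hQ.prop.1.trans le_sup_left, sup_le hQ.prop.2.1 ?_, ?_⟩
    · rwa [Submodule.span_singleton_le_iff_mem]
    · intro y hy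
      rw [LinearMap.BilinForm.mem_orthogonal_iff]
      intro z hz
      obtain ⟨y1, hy1, y2, hy2, rfl⟩ := Submodule.mem_sup.1 hy
      obtain ⟨z1, hz1, z2, hz2, rfl⟩ := Submodule.mem_sup.1 hz
      obtain ⟨a, rfl⟩ := Submodule.mem_span_singleton.1 hy2
      obtain ⟨b, rfl⟩ := Submodule.mem_span_singleton.1 hz2
      have e1 : ω z1 y1 = 0 := hQ.prop.2.2 hy1 z1 hz1
      have e2 : ω z1 x = 0 := hxQ z1 hz1
      have e3 : ω x y1 = 0 := hrefl _ _ (hxQ y1 hy1)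
      simp [e1, e2, e3, hω.self_eq_zero x]
  have := hQ.le_of_ge hmem le_sup_left
  exact this (Submodule.mem_sup_right (Submodule.mem_span_singleton_self x))

/-- This is the dimension formula `dim Q + dim Qᗮ = dim S + dim (Q ∩ rad S)` for `ω` restricted to
`S`, where `Q` is its own orthogonal and contains the radical. -/
lemma two_mul_finrank_of_orthogonal_eq [Finite V] (hω : ω.IsAlt) {S Q : Submodule (ZMod 2) V} (hQS : Q ≤ S)
    (hQ : S ⊓ ω.orthogonal Q = Q) :
    2 * finrank (ZMod 2) Q =
      finrank (ZMod 2) S + finrank (ZMod 2) (S ⊓ ω.orthogonal S : Submodule (ZMod 2) V) := by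
  have hrefl : (ω.restrict S).IsRefl := fun x y h => hω.isRefl _ _ h
  have h := LinearMap.BilinForm.finrank_add_finrank_orthogonal hrefl (Q.comap S.subtype)
  have e1 : (ω.restrict S).orthogonal (Q.comap S.subtype) = Q.comap S.subtype := by
    ext x
    constructor
    · intro hx
      have : (x : V) ∈ S ⊓ ω.orthogonal Q :=
        ⟨x.2, fun z hz => hx ⟨z, hQS hz⟩ hz⟩
      rwa [hQ] at this
    · intro hx z hz
      have hx' : (x : V) ∈ S ⊓ ω.orthogonal Q := by rw [hQ]; exact hx
      exact hx'.2 z hz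
  have e2 : Q.comap S.subtype ⊓ (ω.restrict S).orthogonal ⊤ =
      (S ⊓ ω.orthogonal S).comap S.subtype := by
    ext x
    constructor
    · rintro ⟨-, hx⟩
      exact ⟨x.2, fun z hz => hx ⟨z, hz⟩ trivial⟩
    · rintro ⟨-, hx⟩
      refine ⟨?_, fun z _ => hx z z.2⟩
      have hx' : (x : V) ∈ S ⊓ ω.orthogonal Q := ⟨x.2, fun z hz => hx z (hQS hz)⟩
      rwa [hQ] at hx'
  rw [e1, e2] at h
  have f1 : finrank (ZMod 2) (Q.comap S.subtype) = finrank (ZMod 2) Q :=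
    (Submodule.comapSubtypeEquivOfLe hQS).finrank_eq
  have f2 : finrank (ZMod 2) ((S ⊓ ω.orthogonal S).comap S.subtype) =
      finrank (ZMod 2) (S ⊓ ω.orthogonal S : Submodule (ZMod 2) V) :=
    (Submodule.comapSubtypeEquivOfLe inf_le_left).finrank_eq
  rw [f1, f2] at h
  omega

/-- A transversal of `Q` in `S`, indexed by a type of the right cardinality. -/
lemma exists_transversal [Finite V] {κ : Type*} [Fintype κ] {S Q : Submodule (ZMod 2) V} (hQS : Q ≤ S)
    (hκ : Fintype.card κ * 2 ^ finrank (ZMod 2) Q = 2 ^ finrank (ZMod 2) S) :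
    ∃ t : κ → V, (∀ a, t a ∈ S) ∧ (∀ a a', t a - t a' ∈ Q → a = a') ∧
      ∀ x ∈ S, ∃ a, x - t a ∈ Q := by
  let Q' := Q.comap S.subtype
  have f1 : finrank (ZMod 2) Q' = finrank (ZMod 2) Q :=
    (Submodule.comapSubtypeEquivOfLe hQS).finrank_eq
  have hcard : Nat.card (S ⧸ Q') = Nat.card κ := by
    have h1 := Submodule.finrank_quotient_add_finrank Q'
    rw [Module.natCard_eq_pow_finrank (K := ZMod 2) (V := S ⧸ Q')]
    rw [f1] at h1
    rw [← h1, pow_add] at hκ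
    have := Nat.eq_of_mul_eq_mul_right (by positivity) hκ
    simp [this]
  have : Finite (S ⧸ Q') := Finite.of_surjective _ (Submodule.mkQ_surjective Q')
  have := Fintype.ofFinite (S ⧸ Q')
  rw [Nat.card_eq_fintype_card, Nat.card_eq_fintype_card] at hcard
  let ε : κ ≃ S ⧸ Q' := Fintype.equivOfCardEq hcard.symm
  have hout : ∀ x : S ⧸ Q', Submodule.Quotient.mk (Quotient.out x) = x := fun x => Quotient.out_eq x
  refine ⟨fun a => ((ε a).out : S), fun a => ((ε a).out : S).2, fun a a' h => ?_, fun x hx => ?_⟩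
  · apply ε.injective
    rw [← hout (ε a), ← hout (ε a'), Submodule.Quotient.eq]
    exact h
  · refine ⟨ε.symm (Submodule.Quotient.mk ⟨x, hx⟩), ?_⟩
    have := hout (Submodule.Quotient.mk (p := Q') ⟨x, hx⟩)
    rw [eq_comm, Submodule.Quotient.eq] at this
    have h2 : x - ((Submodule.Quotient.mk (p := Q') ⟨x, hx⟩).out : S) ∈ Q := this
    simpa using h2

/-- A character of `S` which is trivial on `Q` but not on `S` sums to zero over a transversal. -/
lemma sum_sgn_transversal {κ : Type*} [Fintype κ] {S Q : Submodule (ZMod 2) V}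
    {t : κ → V} (htS : ∀ a, t a ∈ S) (hinj : ∀ a a', t a - t a' ∈ Q → a = a')
    (hsurj : ∀ x ∈ S, ∃ a, x - t a ∈ Q) (φ : V →ₗ[ZMod 2] ZMod 2) (hφ : ∀ x ∈ Q, φ x = 0)
    {s : V} (hs : s ∈ S) (hφs : φ s ≠ 0) : ∑ a, sgn (φ (t a)) = 0 := by
  -- Translation by `s` permutes the cosets of `Q` in `S` and flips every sign.
  choose σ hσ using fun a => hsurj (t a + s) (S.add_mem (htS a) hs)
  have hσi : Function.Injective σ := by
    intro a a' h
    apply hinj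
    have := Q.sub_mem (hσ a) (hσ a')
    rw [h] at this
    convert this using 1
    abel
  have hσb : Function.Bijective σ := Finite.injective_iff_bijective.1 hσi
  have h1 : ∑ a, sgn (φ (t a)) = ∑ a, sgn (φ (t (σ a))) :=
    (Function.Bijective.sum_comp hσb (fun a => sgn (φ (t a)))).symm
  have h2 : ∀ a, sgn (φ (t (σ a))) = - sgn (φ (t a)) := by
    intro a
    have := hφ _ (hσ a)
    rw [map_sub, map_add, sub_eq_zero] at this
    rw [← this, sgn_add, sgn_of_ne hφs]
    ring
  rw [Finset.sum_congr rfl fun a _ => h2 a, Finset.sum_neg_distrib] at h1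
  exact self_eq_neg.1 h1

end Isotropic

end EAQ

namespace EAQ

open Module

/-! ### Weyl systems and the subsystem code of a subspace -/

section Weyl

variable {V : Type*} [AddCommGroup V] [Module (ZMod 2) V]
  {H : Type*} [NormedAddCommGroup H] [InnerProductSpace ℂ H]

/-- A projective representation `D` of the symplectic space `(V, ω)` by isometries, with the
commutation relations prescribed by `ω`. -/
structure IsWeylSystem (ω : LinearMap.BilinForm (ZMod 2) V) (D : V → Module.End ℂ H) : Prop where
  zero : ∀ x, D 0 x = x
  add : ∀ u v, ∃ c : ℂ, c ≠ 0 ∧ ∀ x, D u (D v x) = c • D (u + v) x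
  comm : ∀ u v x, D u (D v x) = sgn (ω u v) • D v (D u x)
  inner_map : ∀ u x y, inner ℂ (D u x) (D u y) = inner ℂ x y

variable {ω : LinearMap.BilinForm (ZMod 2) V} {D : V → Module.End ℂ H}

lemma IsWeylSystem.comm_of_eq_zero (hD : IsWeylSystem ω D) {u v : V} (h : ω u v = 0) (x : H) :
    D u (D v x) = D v (D u x) := by
  simpa [h] using hD.comm u v x

lemma add_self_eq_zero_of_zmod_two (v : V) : v + v = 0 := by
  have h : (2 : ZMod 2) • v = v + v := two_smul _ v
  rw [← h, show (2 : ZMod 2) = 0 from rfl, zero_smul]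

lemma IsWeylSystem.norm_map (hD : IsWeylSystem ω D) (u : V) (x : H) : ‖D u x‖ = ‖x‖ := by
  have h := hD.inner_map u x x
  rw [inner_self_eq_norm_sq_to_K, inner_self_eq_norm_sq_to_K] at h
  have h2 : ‖D u x‖ ^ 2 = ‖x‖ ^ 2 := by exact_mod_cast h
  exact (sq_eq_sq₀ (norm_nonneg _) (norm_nonneg _)).1 h2

/-- Operators indexed by an isotropic subspace have a common unit eigenvector. -/
lemma IsWeylSystem.exists_eigenvector [FiniteDimensional ℂ H] [Nontrivial H]
    (hD : IsWeylSystem ω D) {L : Submodule (ZMod 2) V} (hL : L ≤ ω.orthogonal L) :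
    ∃ x : H, ‖x‖ = 1 ∧ ∀ l ∈ L, ∃ μ : ℂ, D l x = μ • x := by
  have hcomm : Pairwise fun i j : L => Commute (D i) (D j) := by
    intro i j _
    ext x
    exact hD.comm_of_eq_zero (hL j.2 i i.2) x
  have htop := Module.End.iSup_iInf_maxGenEigenspace_eq_top_of_iSup_maxGenEigenspace_eq_top_of_commute
    (fun l : L => D l) hcomm (fun l => Module.End.iSup_maxGenEigenspace_eq_top _)
  have hne : ∃ χ : L → ℂ, ⨅ l : L, (D l).maxGenEigenspace (χ l) ≠ ⊥ := by
    by_contra! h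
    simp only [h, iSup_bot] at htop
    exact bot_ne_top htop
  obtain ⟨χ, hχ⟩ := hne
  obtain ⟨x, hx, hx0⟩ := Submodule.exists_mem_ne_zero_of_ne_bot hχ
  have hev : ∀ (l : V) (hl : l ∈ L), D l x = χ ⟨l, hl⟩ • x := by
    intro l hl
    -- Since `l + l = 0`, `D l` squares to a nonzero scalar `c`. As `X² - c` is separable,
    -- generalized eigenvectors are eigenvectors.
    obtain ⟨c, hc, hcD⟩ := hD.add l l
    have hss : (D l).IsFinitelySemisimple := by
      apply Module.End.IsSemisimple.isFinitelySemisimple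
      refine Module.End.isSemisimple_of_squarefree_aeval_eq_zero
        (p := Polynomial.X ^ 2 - Polynomial.C c)
        (Polynomial.separable_X_pow_sub_C c (by norm_num) hc).squarefree ?_
      ext y
      have := hcD y
      rw [add_self_eq_zero_of_zmod_two, hD.zero] at this
      simp [pow_two, this, Module.algebraMap_end_apply]
    have h1 := (Submodule.mem_iInf _).1 hx ⟨l, hl⟩
    rw [hss.maxGenEigenspace_eq_eigenspace] at h1
    exact Module.End.mem_eigenspace_iff.1 h1
  refine ⟨((‖x‖⁻¹ : ℝ) : ℂ) • x, ?_, fun l hl => ⟨χ ⟨l, hl⟩, ?_⟩⟩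
  · rw [norm_smul]
    simp [norm_ne_zero_iff.2 hx0]
  · rw [map_smul, hev l hl, smul_comm]

/-- The vectors `D (s b) (D (t a) x₀)` for transversals `t` of `C / Q₂` and `s` of `Cᗮ / Q₁`: an
orthonormal family spanning a subsystem code which corrects the errors outside `C`. -/
theorem IsWeylSystem.exists_code [FiniteDimensional ℂ H] [Nontrivial H] [Finite V]
    (hD : IsWeylSystem ω D) (hω : ω.IsAlt) (hnd : ω.Nondegenerate) (C : Submodule (ZMod 2) V)
    {κ₁ κ₂ : Type*} [Fintype κ₁] [Fintype κ₂] [DecidableEq κ₁] {k c ρ : ℕ}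
    (hκ₁ : Fintype.card κ₁ = 2 ^ k) (hκ₂ : Fintype.card κ₂ = 2 ^ c)
    (hρ : finrank (ZMod 2) (C ⊓ ω.orthogonal C : Submodule (ZMod 2) V) = ρ)
    (hk : finrank (ZMod 2) C = ρ + 2 * k)
    (hc : finrank (ZMod 2) (ω.orthogonal C) = ρ + 2 * c) :
    ∃ u : κ₁ × κ₂ → H, Orthonormal ℂ u ∧
      (∀ v, v ∉ C ∨ v = 0 → ∃ z : ℂ, ∀ a a',
        ∑ b, inner ℂ (u (a, b)) (D v (u (a', b))) = if a = a' then z else 0) ∧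
      (∀ v ∈ C, v ∉ ω.orthogonal C → ¬ ∃ z : ℂ, ∀ a a',
        ∑ b, inner ℂ (u (a, b)) (D v (u (a', b))) = if a = a' then z else 0) := by
  have hrefl := hω.isRefl
  have hoo : ω.orthogonal (ω.orthogonal C) = C :=
    LinearMap.BilinForm.orthogonal_orthogonal hnd hrefl C
  set S := ω.orthogonal C with hS
  have hsymm : ∀ u v, ω u v = 0 → ω v u = 0 := fun u v h => hrefl u v h
  obtain ⟨Q₂, hradQ₂, hQ₂C, hQ₂⟩ := exists_maximal_isotropic hω C
  obtain ⟨Q₁, hradQ₁, hQ₁S, hQ₁⟩ := exists_maximal_isotropic hω S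
  have d₂ := two_mul_finrank_of_orthogonal_eq hω hQ₂C hQ₂
  have d₁ := two_mul_finrank_of_orthogonal_eq hω hQ₁S hQ₁
  rw [hoo] at d₁ hradQ₁
  rw [inf_comm S C] at d₁ hradQ₁
  rw [← hS] at d₂ hradQ₂
  -- Here `dim Q₂ = ρ + k` and `dim Q₁ = ρ + c`, so the quotients have `2 ^ k` and `2 ^ c` elements.
  obtain ⟨t, htC, htinj, htsurj⟩ := exists_transversal (κ := κ₁) hQ₂C
    (by rw [hκ₁, ← pow_add]; congr 1; omega)
  obtain ⟨s, hsS, hsinj, hssurj⟩ := exists_transversal (κ := κ₂) hQ₁S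
    (by rw [hκ₂, ← pow_add]; congr 1; omega)
  have hCS : ∀ x ∈ C, ∀ y ∈ S, ω x y = 0 := fun x hx y hy => hy x hx
  have hSC : ∀ y ∈ S, ∀ x ∈ C, ω y x = 0 := fun y hy x hx => hsymm _ _ (hCS x hx y hy)
  set L := Q₁ ⊔ Q₂ with hL
  have hQ₁o : Q₁ ≤ ω.orthogonal Q₁ := by conv_lhs => rw [← hQ₁]
                                         exact inf_le_right
  have hQ₂o : Q₂ ≤ ω.orthogonal Q₂ := by conv_lhs => rw [← hQ₂]
                                         exact inf_le_right
  have hLiso : L ≤ ω.orthogonal L := by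
    intro x hx y hy
    obtain ⟨x1, hx1, x2, hx2, rfl⟩ := Submodule.mem_sup.1 hx
    obtain ⟨y1, hy1, y2, hy2, rfl⟩ := Submodule.mem_sup.1 hy
    have e1 : ω y1 x1 = 0 := hQ₁o hx1 y1 hy1
    have e2 : ω y2 x2 = 0 := hQ₂o hx2 y2 hy2
    simp [e1, e2, hSC _ (hQ₁S hy1) _ (hQ₂C hx2), hCS _ (hQ₂C hy2) _ (hQ₁S hx1)]
  -- `L` is Lagrangian: a vector orthogonal to `L` is orthogonal to `C ⊓ S`, so it lies in `S ⊔ C`,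
  -- and its components lie in `Q₁` and `Q₂` by their maximality.
  have hLmax : ∀ x, (∀ l ∈ L, ω l x = 0) → x ∈ L := by
    intro x hx
    have hsup : ω.orthogonal (C ⊓ S) ≤ S ⊔ C := by
      have h1 : ω.orthogonal (S ⊔ C) ≤ C ⊓ S := by
        refine le_inf ?_ ?_
        · refine (LinearMap.BilinForm.orthogonal_le le_sup_left).trans hoo.le
        · exact LinearMap.BilinForm.orthogonal_le le_sup_right
      refine (LinearMap.BilinForm.orthogonal_le h1).trans ?_
      rw [LinearMap.BilinForm.orthogonal_orthogonal hnd hrefl]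
    have hxm : x ∈ S ⊔ C := hsup fun y hy => hx y (Submodule.mem_sup_left (hradQ₁ hy))
    obtain ⟨y, hy, z, hz, rfl⟩ := Submodule.mem_sup.1 hxm
    refine Submodule.add_mem_sup ?_ ?_
    · rw [← hQ₁]
      refine ⟨hy, fun l hl => ?_⟩
      have := hx l (Submodule.mem_sup_left hl)
      rwa [map_add, hSC l (hQ₁S hl) z hz, add_zero] at this
    · rw [← hQ₂]
      refine ⟨hz, fun l hl => ?_⟩
      have := hx l (Submodule.mem_sup_right hl)
      rwa [map_add, hCS l (hQ₂C hl) y hy, zero_add] at this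
  obtain ⟨x₀, hx₀, hev⟩ := hD.exists_eigenvector hLiso
  have hev1 : ∀ l ∈ L, ∃ μ : ℂ, (starRingEnd ℂ) μ * μ = 1 ∧ D l x₀ = μ • x₀ := by
    intro l hl
    obtain ⟨μ, hμ⟩ := hev l hl
    refine ⟨μ, ?_, hμ⟩
    have h := hD.norm_map l x₀
    rw [hμ, norm_smul, hx₀, mul_one] at h
    rw [Complex.conj_mul', h]
    simp
  -- Some `D l` with `l ∈ L` has opposite eigenvalues on the two vectors.
  have hzero : ∀ u w, u + w ∉ L → inner ℂ (D u x₀) (D w x₀) = 0 := by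
    intro u w huw
    have : ∃ l ∈ L, ω l (u + w) ≠ 0 := by
      by_contra! h
      exact huw (hLmax _ h)
    obtain ⟨l, hl, hne⟩ := this
    obtain ⟨μ, hμ1, hμ⟩ := hev1 l hl
    have h := hD.inner_map l (D u x₀) (D w x₀)
    rw [hD.comm l u, hD.comm l w, hμ, map_smul, map_smul, inner_smul_left, inner_smul_right,
      inner_smul_left, inner_smul_right, star_sgn] at h
    have hs : sgn (ω l u) * sgn (ω l w) = -1 := by
      rw [← sgn_add, ← map_add, sgn_of_ne hne]
    have h2 : inner ℂ (D u x₀) (D w x₀) = -inner ℂ (D u x₀) (D w x₀) := by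
      conv_lhs => rw [← h]
      linear_combination (sgn (ω l u) * sgn (ω l w) * inner ℂ (D u x₀) (D w x₀)) * hμ1 +
        inner ℂ (D u x₀) (D w x₀) * hs
    exact self_eq_neg.1 h2
  -- Here `D u x₀` and `D w x₀` are proportional.
  have hnz : ∀ u w, u + w ∈ L → inner ℂ (D u x₀) (D w x₀) ≠ 0 := by
    intro u w huw
    obtain ⟨μ, hμ1, hμ⟩ := hev1 _ huw
    obtain ⟨d, hd, hdD⟩ := hD.add u (u + w)
    have h := hdD x₀
    rw [← add_assoc, add_self_eq_zero_of_zmod_two, zero_add, hμ, map_smul] at h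
    have hin : inner ℂ (D u x₀) (μ • D u x₀) = μ := by
      rw [inner_smul_right, hD.inner_map, inner_self_eq_norm_sq_to_K, hx₀]
      simp
    rw [h, inner_smul_right] at hin
    intro h0
    rw [h0, mul_zero] at hin
    rw [← hin] at hμ1
    simp at hμ1
  have hsub : ∀ x y : V, x - y = x + y := fun x y => by
    rw [sub_eq_iff_eq_add, add_assoc, add_self_eq_zero_of_zmod_two, add_zero]
  let u : κ₁ × κ₂ → H := fun p => D (s p.2) (D (t p.1) x₀)
  have hinner : ∀ v a a' b, inner ℂ (u (a, b)) (D v (u (a', b))) =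
      sgn (ω v (s b)) * inner ℂ (D (t a) x₀) (D v (D (t a') x₀)) := by
    intro v a a' b
    simp only [u]
    rw [hD.comm v (s b), inner_smul_right, hD.inner_map]
  -- Moving `D v` past `D (s b)` costs only a sign, so a character sum over `b` splits off.
  have hsum : ∀ v a a', ∑ b, inner ℂ (u (a, b)) (D v (u (a', b))) =
      (∑ b, sgn (ω v (s b))) * inner ℂ (D (t a) x₀) (D v (D (t a') x₀)) := by
    intro v a a'
    rw [Finset.sum_mul]
    exact Finset.sum_congr rfl fun b _ => hinner v a a' b
  have hmerge : ∀ v a, ∃ d : ℂ, d ≠ 0 ∧ D v (D (t a) x₀) = d • D (v + t a) x₀ := by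
    intro v a
    obtain ⟨d, hd, h⟩ := hD.add v (t a)
    exact ⟨d, hd, h x₀⟩
  have horth : ∀ a a', a ≠ a' → inner ℂ (D (t a) x₀) (D (t a') x₀) = 0 := by
    intro a a' hne
    apply hzero
    intro hmem
    apply hne
    obtain ⟨y1, hy1, y2, hy2, hy⟩ := Submodule.mem_sup.1 hmem
    apply htinj
    rw [hsub, ← hy]
    refine Q₂.add_mem (hradQ₂ ⟨?_, hQ₁S hy1⟩) hy2
    have : y1 = t a + t a' - y2 := by rw [← hy]; abel
    rw [this]
    exact C.sub_mem (C.add_mem (htC a) (htC a')) (hQ₂C hy2)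
  refine ⟨u, ?_, ?_, ?_⟩
  · classical
    rw [orthonormal_iff_ite]
    rintro ⟨a, b⟩ ⟨a', b'⟩
    split_ifs with h
    · cases h
      simp only [u]
      rw [hD.inner_map, hD.inner_map, inner_self_eq_norm_sq_to_K, hx₀]
      simp
    · simp only [u]
      obtain ⟨d, hd, h1⟩ := hmerge (s b) a
      obtain ⟨d', hd', h2⟩ := hmerge (s b') a'
      rw [h1, h2, inner_smul_left, inner_smul_right, hzero, mul_zero, mul_zero]
      intro hmem
      apply h
      obtain ⟨y1, hy1, y2, hy2, hy⟩ := Submodule.mem_sup.1 hmem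
      -- The left side is in `S` and the right side in `C`, so both are in the radical, which `Q₁`
      -- and `Q₂` contain.
      have e : (s b + s b') + y1 = (t a + t a') + y2 := by
        rw [← hsub _ y1, sub_eq_iff_eq_add]
        have : s b + s b' = (y1 + y2) + (t a + t a') := by
          rw [hy, ← hsub _ (t a + t a')]
          abel
        rw [this]
        abel
      have m1 : (s b + s b') + y1 ∈ S := S.add_mem (S.add_mem (hsS b) (hsS b')) (hQ₁S hy1)
      have m2 : (t a + t a') + y2 ∈ C := C.add_mem (C.add_mem (htC a) (htC a')) (hQ₂C hy2)
      have hb : s b - s b' ∈ Q₁ := by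
        rw [hsub]
        have := Q₁.sub_mem (hradQ₁ ⟨e ▸ m2, m1⟩) hy1
        simpa using this
      have ha : t a - t a' ∈ Q₂ := by
        rw [hsub]
        have := Q₂.sub_mem (hradQ₂ ⟨m2, e ▸ m1⟩) hy2
        simpa using this
      rw [htinj _ _ ha, hsinj _ _ hb]
  · rintro v (hv | rfl)
    · refine ⟨0, fun a a' => ?_⟩
      rw [hsum, ite_self]
      -- If this vector is in `L`, then `v` is `y1 ∈ Q₁` plus an element of `C`, with `y1 ∉ C`. The
      -- character `ω y1` is trivial on `Q₁` but not on `S`, so the sum over `b` vanishes. Otherwise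
      -- the inner product vanishes.
      by_cases hmem : t a + (v + t a') ∈ L
      · obtain ⟨y1, hy1, y2, hy2, hy⟩ := Submodule.mem_sup.1 hmem
        have hv' : v = y1 + (y2 + (t a + t a')) := by
          rw [← add_assoc, hy, ← hsub _ (t a + t a')]
          abel
        have hyC : y2 + (t a + t a') ∈ C :=
          C.add_mem (hQ₂C hy2) (C.add_mem (htC a) (htC a'))
        have hy1C : y1 ∉ C := fun h => hv (hv' ▸ C.add_mem h hyC)
        have : ∃ z ∈ S, ω y1 z ≠ 0 := by
          by_contra! h
          apply hy1C
          rw [← hoo]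
          exact fun z hz => hsymm _ _ (h z hz)
        obtain ⟨z, hz, hz0⟩ := this
        have e : ∀ b, ω v (s b) = ω y1 (s b) := by
          intro b
          rw [hv', map_add, LinearMap.add_apply, hCS _ hyC _ (hsS b), add_zero]
        rw [Finset.sum_congr rfl fun b _ => by rw [e b],
          sum_sgn_transversal hsS hsinj hssurj (ω y1) (fun x hx => hQ₁o hx y1 hy1) hz hz0, zero_mul]
      · obtain ⟨d, hd, h⟩ := hmerge v a'
        rw [h, inner_smul_right, hzero _ _ hmem, mul_zero, mul_zero]
    · refine ⟨∑ b, sgn (ω 0 (s b)), fun a a' => ?_⟩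
      rw [hsum, hD.zero]
      split_ifs with h
      · rw [h, hD.inner_map, inner_self_eq_norm_sq_to_K, hx₀]
        simp
      · rw [horth a a' h, mul_zero]
  · rintro v hvC hvS ⟨z, hz⟩
    have hcard : (∑ b, sgn (ω v (s b))) ≠ 0 := by
      simp [hCS v hvC _ (hsS _), hκ₂]
    have key : ∀ a a', inner ℂ (D (t a) x₀) (D v (D (t a') x₀)) =
        if a = a' then z / (∑ b, sgn (ω v (s b))) else 0 := by
      intro a a'
      have h := hz a a'
      rw [hsum] at h
      split_ifs with h1
      · rw [if_pos h1] at h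
        rw [eq_div_iff hcard, mul_comm]
        exact h
      · rw [if_neg h1] at h
        exact (mul_eq_zero.1 h).resolve_left hcard
    -- Outside `Q₂`, `D v` would carry one coset of `Q₂` in `C` to another and leave a nonzero
    -- off-diagonal entry.
    have hvQ : v ∈ Q₂ := by
      obtain ⟨a', -⟩ := htsurj 0 C.zero_mem
      obtain ⟨a, ha⟩ := htsurj (v + t a') (C.add_mem hvC (htC a'))
      have hmem : t a + (v + t a') ∈ Q₂ := by
        rwa [hsub, add_comm] at ha
      obtain ⟨d, hd, h⟩ := hmerge v a'
      have h1 := hnz _ _ (Submodule.mem_sup_right hmem : t a + (v + t a') ∈ L)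
      have h2 := key a a'
      rw [h, inner_smul_right] at h2
      have haa : a = a' := by
        by_contra hne
        rw [if_neg hne] at h2
        exact (mul_ne_zero hd h1) h2
      rw [haa] at hmem
      have : t a' + (v + t a') = v := by
        rw [add_comm v, ← add_assoc, add_self_eq_zero_of_zmod_two, zero_add]
      rwa [this] at hmem
    -- Elements of `Q₂` act diagonally by `±μ`; because `v ∉ S`, both signs occur on `C / Q₂`, so
    -- the action is not scalar.
    have : ∃ y ∈ C, ω v y ≠ 0 := by
      by_contra! h
      exact hvS fun y hy => hsymm _ _ (h y hy)
    obtain ⟨y, hyC, hy0⟩ := this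
    obtain ⟨μ, hμ1, hμ⟩ := hev1 v (Submodule.mem_sup_right hvQ)
    have hdiag : ∀ a, inner ℂ (D (t a) x₀) (D v (D (t a) x₀)) = sgn (ω v (t a)) * μ := by
      intro a
      rw [hD.comm v, hμ, map_smul, inner_smul_right, inner_smul_right, hD.inner_map,
        inner_self_eq_norm_sq_to_K, hx₀]
      simp
    obtain ⟨a, ha⟩ := htsurj 0 C.zero_mem
    obtain ⟨a', ha'⟩ := htsurj y hyC
    have h1 : ω v (t a) = 0 := by
      have := hQ₂o ha v hvQ
      simpa using this
    have h2 : ω v (t a') ≠ 0 := by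
      have : ω v (y - t a') = 0 := hQ₂o ha' v hvQ
      rw [map_sub, sub_eq_zero] at this
      rwa [← this]
    have k1 := key a a
    have k2 := key a' a'
    rw [hdiag, if_pos rfl] at k1 k2
    rw [← k1, h1, sgn_of_ne h2, sgn_zero] at k2
    have hμ0 : μ ≠ 0 := by
      rintro rfl
      simp at hμ1
    apply hμ0
    linear_combination (-1/2 : ℂ) * k2

end Weyl

end EAQ

namespace EAQ

open Module

/-! ### The Knill–Laflamme condition in terms of an orthonormal family -/

section Encode

variable {q n k c : ℕ}

/-- The operator on `n` qudits given by a matrix. -/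
noncomputable def opOf (E : Matrix (Fin n → Fin q) (Fin n → Fin q) ℂ) :
    Module.End ℂ (Qudits q n) := Matrix.toEuclideanLin E

lemma opOf_apply (E : Matrix (Fin n → Fin q) (Fin n → Fin q) ℂ) (x : Qudits q n)
    (i : Fin n → Fin q) : opOf E x i = ∑ y, E i y * x y := by
  simp [opOf, Matrix.toLpLin_apply, Matrix.mulVec, dotProduct]

lemma encode_apply (U : BiQudits q k c →ₗᵢ[ℂ] Qudits q n) (ψ : Qudits q k)
    (p : (Fin n → Fin q) × (Fin c → Fin q)) :
    encode U ψ p = (((Real.sqrt ((q : ℝ) ^ c))⁻¹ : ℝ) : ℂ) *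
      ∑ a, ψ a * U (EuclideanSpace.single (a, p.2) 1) p.1 := by
  have h : (WithLp.toLp 2 fun y : (Fin k → Fin q) × (Fin c → Fin q) =>
      ψ y.1 * maxEntangled q c (y.2, p.2) : BiQudits q k c) =
      (((Real.sqrt ((q : ℝ) ^ c))⁻¹ : ℝ) : ℂ) • ∑ a, ψ a • EuclideanSpace.single (a, p.2) (1 : ℂ) := by
    ext ⟨a, b⟩
    simp only [maxEntangled, PiLp.smul_apply, WithLp.ofLp_sum, WithLp.ofLp_smul,
      Finset.sum_apply, Pi.smul_apply, smul_eq_mul, PiLp.single_apply, Prod.mk.injEq]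
    by_cases hb : b = p.2
    · simp [hb, mul_comm]
    · simp [hb]
  simp only [encode]
  rw [h, map_smul, map_sum]
  simp

/-- The error leaves the receiver's index alone, so bra and ket share it and it survives only as the
sum over `b`; the prefactor is `q ^ (-c)`. -/
lemma inner_encode_applyError (U : BiQudits q k c →ₗᵢ[ℂ] Qudits q n)
    (E : Matrix (Fin n → Fin q) (Fin n → Fin q) ℂ) (φ ψ : Qudits q k) :
    inner ℂ (encode U φ) (applyError E (encode U ψ)) =
      (((Real.sqrt ((q : ℝ) ^ c))⁻¹ : ℝ) : ℂ) ^ 2 *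
      ∑ a, ∑ a', (starRingEnd ℂ) (φ a) * ψ a' * ∑ b, inner ℂ (U (EuclideanSpace.single (a, b) 1))
        (opOf E (U (EuclideanSpace.single (a', b) 1))) := by
  set σ : ℂ := (((Real.sqrt ((q : ℝ) ^ c))⁻¹ : ℝ) : ℂ) with hσ
  have hσs : (starRingEnd ℂ) σ = σ := Complex.conj_ofReal _
  let w : Qudits q k → (Fin c → Fin q) → Qudits q n :=
    fun ψ b => ∑ a, ψ a • U (EuclideanSpace.single (a, b) 1)
  have h0 : ∀ ψ x b, encode U ψ (x, b) = σ * w ψ b x := by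
    intro ψ x b
    rw [encode_apply]
    simp [w, hσ]
  have h1 : ∀ x b, applyError E (encode U ψ) (x, b) = σ * opOf E (w ψ b) x := by
    intro x b
    simp only [applyError, opOf_apply, Finset.mul_sum]
    refine Finset.sum_congr rfl fun y _ => ?_
    rw [h0]
    ring
  have h2 : inner ℂ (encode U φ) (applyError E (encode U ψ)) =
      σ ^ 2 * ∑ b, inner ℂ (w φ b) (opOf E (w ψ b)) := by
    rw [PiLp.inner_apply, Fintype.sum_prod_type, Finset.sum_comm, Finset.mul_sum]
    refine Finset.sum_congr rfl fun b _ => ?_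
    rw [PiLp.inner_apply, Finset.mul_sum]
    refine Finset.sum_congr rfl fun x _ => ?_
    rw [h0, h1, RCLike.inner_apply, RCLike.inner_apply, map_mul, hσs]
    ring
  rw [h2]
  congr 1
  simp only [w, map_sum, sum_inner, inner_sum, map_smul, inner_smul_left, inner_smul_right,
    Finset.mul_sum]
  rw [Finset.sum_comm]
  conv_rhs => rw [Finset.sum_comm]
  refine Finset.sum_congr rfl fun a _ => ?_
  rw [Finset.sum_comm]
  refine Finset.sum_congr rfl fun a' _ => Finset.sum_congr rfl fun b _ => ?_
  ring

/-- The isometry that maps the standard basis to a given orthonormal family. -/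
noncomputable def isometryOf (u : (Fin k → Fin q) × (Fin c → Fin q) → Qudits q n)
    (hu : Orthonormal ℂ u) : BiQudits q k c →ₗᵢ[ℂ] Qudits q n :=
  ((EuclideanSpace.basisFun _ ℂ).toBasis.constr ℂ u).isometryOfOrthonormal
    (v := (EuclideanSpace.basisFun _ ℂ).toBasis)
    (by simp)
    (by
      convert hu
      ext1 p
      rw [Function.comp_apply, Basis.constr_basis])

lemma isometryOf_single (u : (Fin k → Fin q) × (Fin c → Fin q) → Qudits q n)
    (hu : Orthonormal ℂ u) (p : (Fin k → Fin q) × (Fin c → Fin q)) :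
    isometryOf u hu (EuclideanSpace.single p 1) = u p := by
  have h := Basis.constr_basis (EuclideanSpace.basisFun _ ℂ).toBasis ℂ u p
  rw [OrthonormalBasis.coe_toBasis, EuclideanSpace.basisFun_apply] at h
  exact h

/-- By sesquilinearity it is enough to test basis messages; the factor `q ^ (-c)`, nonzero because
`q > 0`, is absorbed into `z`. -/
lemma detects_iff (hq : 0 < q) (u : (Fin k → Fin q) × (Fin c → Fin q) → Qudits q n)
    (hu : Orthonormal ℂ u) (E : Matrix (Fin n → Fin q) (Fin n → Fin q) ℂ) :
    Detects (isometryOf u hu) E ↔ ∃ z : ℂ, ∀ a a',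
      ∑ b, inner ℂ (u (a, b)) (opOf E (u (a', b))) = if a = a' then z else 0 := by
  have hσ : (((Real.sqrt ((q : ℝ) ^ c))⁻¹ : ℝ) : ℂ) ^ 2 ≠ 0 := by
    have : (0 : ℝ) < q := by exact_mod_cast hq
    have : (Real.sqrt ((q : ℝ) ^ c))⁻¹ ≠ 0 := by positivity
    exact pow_ne_zero _ (by exact_mod_cast this)
  constructor
  · rintro ⟨z, hz⟩
    refine ⟨z / (((Real.sqrt ((q : ℝ) ^ c))⁻¹ : ℝ) : ℂ) ^ 2, fun a a' => ?_⟩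
    have h := hz (EuclideanSpace.single a 1) (EuclideanSpace.single a' 1)
    rw [inner_encode_applyError, Finset.sum_eq_single a, Finset.sum_eq_single a'] at h
    · simp only [isometryOf_single, PiLp.single_apply, if_true, map_one, one_mul] at h
      rw [EuclideanSpace.inner_single_left, map_one, one_mul, PiLp.single_apply] at h
      split_ifs at h ⊢ with h1
      · rw [eq_div_iff hσ, mul_comm, h, mul_one]
      · rw [mul_zero] at h
        exact (mul_eq_zero.1 h).resolve_left hσ
    · intro b _ hb
      simp [hb]
    · simp
    · intro b _ hb
      simp [hb]
    · simp
  · rintro ⟨z, hz⟩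
    refine ⟨(((Real.sqrt ((q : ℝ) ^ c))⁻¹ : ℝ) : ℂ) ^ 2 * z, fun φ ψ => ?_⟩
    rw [inner_encode_applyError, mul_assoc]
    congr 1
    simp only [isometryOf_single, hz, mul_ite, mul_zero, Finset.sum_ite_eq, Finset.mem_univ,
      if_true]
    rw [PiLp.inner_apply, Finset.mul_sum]
    simp only [RCLike.inner_apply]
    exact Finset.sum_congr rfl fun a _ => by ring

end Encode

/-! ### Tensor products of matrices -/

section Tensor

variable {ι X : Type*} [Fintype ι]

/-- The tensor product of a family of matrices. -/
def tens (A : ι → Matrix X X ℂ) : Matrix (ι → X) (ι → X) ℂ :=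
  Matrix.of fun x y => ∏ i, A i (x i) (y i)

lemma tens_mul [DecidableEq ι] [Fintype X] (A B : ι → Matrix X X ℂ) :
    tens A * tens B = tens fun i => A i * B i := by
  ext x y
  simp only [tens, Matrix.mul_apply, Matrix.of_apply]
  rw [Finset.prod_univ_sum, Fintype.piFinset_univ]
  exact Finset.sum_congr rfl fun z _ => Finset.prod_mul_distrib.symm

lemma tens_smul (c : ι → ℂ) (A : ι → Matrix X X ℂ) :
    tens (fun i => c i • A i) = (∏ i, c i) • tens A := by
  ext x y
  simp [tens, Finset.prod_mul_distrib]

lemma tens_one [DecidableEq X] : tens (fun _ : ι => (1 : Matrix X X ℂ)) = 1 := by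
  ext x y
  simp only [tens, Matrix.of_apply, Matrix.one_apply, Fintype.prod_ite_zero, Finset.prod_const_one,
    funext_iff]

lemma tens_conjTranspose (A : ι → Matrix X X ℂ) :
    (tens A).conjTranspose = tens fun i => (A i).conjTranspose := by
  ext x y
  simp [tens, Matrix.conjTranspose_apply]

end Tensor

end EAQ

namespace EAQ

open Module

/-! ### Pauli operators on one qudit -/

section Qudit

variable {F : Type*} [Field F]

lemma add_pow_two_pow [CharP F 2] (e : ℕ) (x y : F) : (x + y) ^ 2 ^ e = x ^ 2 ^ e + y ^ 2 ^ e :=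
  add_pow_char_pow x y 2 e

lemma trace_pow_two_pow [Algebra (ZMod 2) F] [Finite F] (e : ℕ) (x : F) :
    Algebra.trace (ZMod 2) F (x ^ 2 ^ e) = Algebra.trace (ZMod 2) F x := by
  induction e generalizing x with
  | zero => simp
  | succ e ih =>
    rw [pow_succ, pow_mul]
    have h := Algebra.trace_eq_of_algEquiv
      (FiniteField.frobeniusAlgEquivOfAlgebraic (ZMod 2) F) (x ^ 2 ^ e)
    rw [FiniteField.coe_frobeniusAlgEquivOfAlgebraic, ZMod.card] at h
    rw [← ih x]
    exact h

lemma exists_trace_mul_ne_zero [Algebra (ZMod 2) F] [Finite F] {a : F} (ha : a ≠ 0) :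
    ∃ b, Algebra.trace (ZMod 2) F (b * a) ≠ 0 := by
  by_contra! h
  apply ha
  refine (traceForm_nondegenerate (ZMod 2) F).1 a fun b => ?_
  rw [Algebra.traceForm_apply, mul_comm]
  exact h b

/-- The fixed points of `x ↦ x ^ (2 ^ e)`. -/
def fixedPow (F : Type*) [Field F] [CharP F 2] (e : ℕ) : AddSubgroup F where
  carrier := {x | x ^ 2 ^ e = x}
  zero_mem' := by simp
  add_mem' {x y} hx hy := by
    simp only [Set.mem_ofPred_eq] at *
    rw [add_pow_two_pow, hx, hy]
  neg_mem' {x} hx := by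
    simp only [Set.mem_ofPred_eq] at *
    rw [CharTwo.neg_eq, hx]

lemma mem_fixedPow [CharP F 2] {e : ℕ} {x : F} : x ∈ fixedPow F e ↔ x ^ 2 ^ e = x := Iff.rfl

lemma mul_mem_fixedPow [CharP F 2] {e : ℕ} {x y : F} (hx : x ∈ fixedPow F e) (hy : y ∈ fixedPow F e) :
    x * y ∈ fixedPow F e := by
  rw [mem_fixedPow] at *
  rw [mul_pow, hx, hy]

lemma sum_sgn_eq_zero {G : Type*} [AddGroup G] [Fintype G] (φ : G → ZMod 2)
    (hφ : ∀ x y, φ (x + y) = φ x + φ y) {g : G} (hg : φ g ≠ 0) : ∑ x, sgn (φ x) = 0 := by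
  have h1 := Equiv.sum_comp (Equiv.addRight g) (fun x => sgn (φ x))
  simp only [Equiv.coe_addRight, hφ, sgn_add, sgn_of_ne hg, mul_neg, mul_one,
    Finset.sum_neg_distrib] at h1
  exact self_eq_neg.1 h1.symm

variable [Fintype F] {e : ℕ}

lemma pow_pow_two_pow (hF : Fintype.card F = (2 ^ e) ^ 2) (x : F) : (x ^ 2 ^ e) ^ 2 ^ e = x := by
  rw [← pow_mul, ← pow_two, ← hF, FiniteField.pow_card]

/-- An element `θ` with `θ + θ ^ q = 1`. -/
lemma exists_add_pow_eq_one [CharP F 2] (he : 0 < e) (hF : Fintype.card F = (2 ^ e) ^ 2) :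
    ∃ θ : F, θ + θ ^ 2 ^ e = 1 := by
  -- Otherwise all `q²` elements would be roots of `X ^ q - X`. Dividing such a `u` by `u + u ^ q`,
  -- which the `q`-power map fixes, gives `θ`.
  have h : ∃ u : F, u + u ^ 2 ^ e ≠ 0 := by
    by_contra! h
    have hroot : ∀ u : F, u ∈ (Polynomial.X ^ 2 ^ e - Polynomial.X : Polynomial F).roots := by
      intro u
      rw [Polynomial.mem_roots (FiniteField.X_pow_card_pow_sub_X_ne_zero F he.ne' one_lt_two)]
      have := CharTwo.add_eq_zero.1 (h u)
      simp [← this]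
    have h1 : Fintype.card F ≤ 2 ^ e := by
      classical
      calc Fintype.card F = (Finset.univ : Finset F).card := rfl
        _ ≤ (Polynomial.X ^ 2 ^ e - Polynomial.X : Polynomial F).roots.toFinset.card :=
          Finset.card_le_card fun u _ => Multiset.mem_toFinset.2 (hroot u)
        _ ≤ Multiset.card (Polynomial.X ^ 2 ^ e - Polynomial.X : Polynomial F).roots :=
          Multiset.toFinset_card_le _
        _ ≤ (Polynomial.X ^ 2 ^ e - Polynomial.X : Polynomial F).natDegree :=
          Polynomial.card_roots' _
        _ = 2 ^ e := FiniteField.X_pow_card_pow_sub_X_natDegree_eq F he.ne' one_lt_two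
    rw [hF] at h1
    have h2 : 1 < 2 ^ e := Nat.one_lt_two_pow he.ne'
    nlinarith
  obtain ⟨u, hu⟩ := h
  have hfix : (u + u ^ 2 ^ e) ^ 2 ^ e = u + u ^ 2 ^ e := by
    rw [add_pow_two_pow, pow_pow_two_pow hF, add_comm]
  refine ⟨u / (u + u ^ 2 ^ e), ?_⟩
  rw [div_pow, hfix, ← add_div, div_self hu]

/-- The Pauli operators on one qudit of dimension `q`, indexed by the field with `q ^ 2`
elements. -/
theorem exists_qudit_pauli [CharP F 2] [Algebra (ZMod 2) F] (he : 0 < e) (hF : Fintype.card F = (2 ^ e) ^ 2) :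
    ∃ (w : F → Matrix (Fin (2 ^ e)) (Fin (2 ^ e)) ℂ) (η : F → F → ZMod 2), w 0 = 1 ∧
      (∀ u v, w u * w v = sgn (η u v) • w (u + v)) ∧
      (∀ u v, w u * w v = sgn (Algebra.trace (ZMod 2) F (u * v ^ 2 ^ e)) • (w v * w u)) ∧
      (∀ u, (w u).conjTranspose * w u = 1) ∧
      (∀ x y x' y', ∑ v, w v x y * (starRingEnd ℂ) (w v x' y') =
        if x = x' ∧ y = y' then (2 ^ e : ℂ) else 0) := by
  classical
  obtain ⟨θ, hθ⟩ := exists_add_pow_eq_one he hF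
  set tr := Algebra.trace (ZMod 2) F with htr
  let B := fixedPow F e
  -- Coordinates with respect to `1, θ` over the fixed field `B` of order `q`: `u = X + θ Z` with `Z
  -- = u + u ^ q`.
  have hZ : ∀ u : F, u + u ^ 2 ^ e ∈ B := fun u => by
    rw [mem_fixedPow, add_pow_two_pow, pow_pow_two_pow hF, add_comm]
  have hX : ∀ u : F, u + θ * (u + u ^ 2 ^ e) ∈ B := fun u => by
    rw [mem_fixedPow, add_pow_two_pow, mul_pow, mem_fixedPow.1 (hZ u)]
    have : θ ^ 2 ^ e = 1 - θ := by rw [← hθ]; ring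
    rw [this, CharTwo.sub_eq_add]
    linear_combination (u ^ 2 ^ e) * (CharTwo.two_eq_zero (R := F))
  let Z : F → B := fun u => ⟨_, hZ u⟩
  let Xc : F → B := fun u => ⟨_, hX u⟩
  have hXZ : ∀ u : F, u = Xc u + θ * Z u := fun u => by
    simp only [Xc, Z]
    linear_combination (-θ * (u + u ^ 2 ^ e)) * (CharTwo.two_eq_zero (R := F))
  have hXadd : ∀ u v, Xc (u + v) = Xc u + Xc v := fun u v => by
    ext
    simp only [Xc, AddSubgroup.coe_add, add_pow_two_pow]
    ring
  have hZadd : ∀ u v, Z (u + v) = Z u + Z v := fun u v => by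
    ext
    simp only [Z, AddSubgroup.coe_add, add_pow_two_pow]
    ring
  -- For `x ∈ B`, `x = θ x + (θ x) ^ q`, and the two summands have equal trace.
  have htrB : ∀ x ∈ B, tr x = 0 := by
    intro x hx
    have h1 : tr (θ * x + (θ * x) ^ 2 ^ e) = tr x := by
      rw [mul_pow, mem_fixedPow.1 hx, ← add_mul, hθ, one_mul]
    rw [← h1, map_add, trace_pow_two_pow, CharTwo.add_self_eq_zero]
  have hB2 : ∀ x : B, x + x = 0 := fun x => by ext; exact CharTwo.add_self_eq_zero _
  have hBadd : ∀ x y z : B, x + y = z ↔ y = x + z := fun x y z => by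
    constructor
    · rintro rfl
      rw [← add_assoc, hB2, zero_add]
    · rintro rfl
      rw [← add_assoc, hB2, zero_add]
  let φ : F ≃ B × B :=
    { toFun := fun u => (Xc u, Z u)
      invFun := fun p => p.1 + θ * p.2
      left_inv := fun u => (hXZ u).symm
      right_inv := by
        rintro ⟨a, b⟩
        have ha := mem_fixedPow.1 a.2
        have hb := mem_fixedPow.1 b.2
        have hz : ((a : F) + θ * b) + ((a : F) + θ * b) ^ 2 ^ e = b := by
          rw [add_pow_two_pow, mul_pow, ha, hb]
          linear_combination (b : F) * hθ + (a : F) * (CharTwo.two_eq_zero (R := F))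
        refine Prod.ext (Subtype.ext ?_) (Subtype.ext ?_)
        · simp only [Xc, hz]
          linear_combination (θ * b) * (CharTwo.two_eq_zero (R := F))
        · simp only [Z, hz] }
  have hBcard : Fintype.card B = 2 ^ e := by
    have h := Fintype.card_congr φ
    rw [hF, Fintype.card_prod, ← pow_two] at h
    exact (Nat.pow_left_injective (two_ne_zero) h).symm
  let ε : Fin (2 ^ e) ≃ B := (Fintype.equivFinOfCardEq hBcard).symm
  -- A shift by the coordinate `Xc u` combined with the phase given by the character `x ↦ tr (θ Z
  -- x)`.
  let w' : F → Matrix B B ℂ := fun u => Matrix.of fun x y =>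
    if x + y = Xc u then sgn (tr (θ * Z u * x)) else 0
  have hmul : ∀ u v, w' u * w' v = sgn (tr (θ * Z v * Xc u)) • w' (u + v) := by
    intro u v
    ext x y
    simp only [w', Matrix.mul_apply, Matrix.of_apply, hBadd x, ite_mul, zero_mul,
      Finset.sum_ite_eq', Finset.mem_univ, if_true, Matrix.smul_apply, smul_eq_mul]
    have hiff : (x + Xc u + y = Xc v) ↔ (y = x + Xc (u + v)) := by
      rw [hBadd, hXadd, add_assoc]
    by_cases h : x + Xc u + y = Xc v
    · rw [if_pos h, if_pos (hiff.1 h), ← sgn_add, ← sgn_add, hZadd]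
      congr 1
      rw [← map_add, ← map_add]
      congr 1
      push_cast
      ring
    · rw [if_neg h, if_neg (fun h' => h (hiff.2 h'))]
      simp
  -- Expanded in coordinates, `u v ^ q` is the sum of the two phase terms and an element of `B`,
  -- whose trace is zero.
  have hη : ∀ u v, tr (θ * Z v * Xc u) = tr (u * v ^ 2 ^ e) + tr (θ * Z u * Xc v) := by
    intro u v
    have e1 : u * v ^ 2 ^ e = ((Xc u : F) * Xc v + (Xc u : F) * Z v + (θ * θ ^ 2 ^ e) * (Z u * Z v)) +
        (θ * Z v * Xc u + θ * Z u * Xc v) := by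
      conv_lhs => rw [hXZ u, hXZ v]
      rw [add_pow_two_pow, mul_pow, mem_fixedPow.1 (Xc v).2, mem_fixedPow.1 (Z v).2]
      have : θ ^ 2 ^ e = 1 + θ := by rw [← hθ]; linear_combination (-θ) * (CharTwo.two_eq_zero (R := F))
      rw [this]
      ring
    have hm : (Xc u : F) * Xc v + (Xc u : F) * Z v + (θ * θ ^ 2 ^ e) * (Z u * Z v) ∈ B := by
      refine B.add_mem (B.add_mem ?_ ?_) ?_
      · exact mul_mem_fixedPow (Xc u).2 (Xc v).2
      · exact mul_mem_fixedPow (Xc u).2 (Z v).2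
      · refine mul_mem_fixedPow ?_ (mul_mem_fixedPow (Z u).2 (Z v).2)
        rw [mem_fixedPow, mul_pow, pow_pow_two_pow hF, mul_comm]
    rw [e1, map_add, htrB _ hm, map_add, zero_add, add_assoc, CharTwo.add_self_eq_zero, add_zero]
  refine ⟨fun u => (w' u).submatrix ε ε, fun u v => tr (θ * Z v * Xc u), ?_, ?_, ?_, ?_, ?_⟩
  · have hX0 : Xc 0 = 0 := by ext; simp [Xc]
    have hZ0 : Z 0 = 0 := by ext; simp [Z]
    have : w' 0 = 1 := by
      ext x y
      simp only [w', Matrix.of_apply, Matrix.one_apply, hX0, hZ0, hBadd, add_zero]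
      simp [eq_comm]
    simp only [this]
    exact Matrix.submatrix_one_equiv ε
  · intro u v
    rw [Matrix.submatrix_mul_equiv, hmul]
    rfl
  · intro u v
    rw [Matrix.submatrix_mul_equiv, Matrix.submatrix_mul_equiv, hmul, hmul v u, hη, sgn_add,
      add_comm v u, ← smul_smul]
    rfl
  · intro u
    rw [Matrix.conjTranspose_submatrix, Matrix.submatrix_mul_equiv]
    have : (w' u).conjTranspose * w' u = 1 := by
      ext x y
      simp only [w', Matrix.mul_apply, Matrix.conjTranspose_apply, Matrix.of_apply]
      rw [Finset.sum_eq_single (x + Xc u)]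
      · have h1 : x + Xc u + x = Xc u := by rw [add_comm, ← add_assoc, hB2, zero_add]
        rw [if_pos h1, Matrix.one_apply]
        by_cases h : x = y
        · subst h
          rw [if_pos h1, if_pos rfl]
          simpa using sgn_mul_self _
        · rw [if_neg, if_neg h, mul_zero]
          intro h2
          apply h
          exact (add_left_cancel (h2.trans h1.symm)).symm
      · intro z _ hz
        rw [if_neg, star_zero, zero_mul]
        intro h
        apply hz
        rw [add_comm] at h
        exact (hBadd _ _ _).1 h
      · simp
    rw [this]
    exact Matrix.submatrix_one_equiv ε
  · intro x y x' y'
    have key : ∀ x y x' y' : B, ∑ v, w' v x y * (starRingEnd ℂ) (w' v x' y') =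
        if x = x' ∧ y = y' then (2 ^ e : ℂ) else 0 := by
      intro x y x' y'
      have h1 : ∀ v, w' v x y * (starRingEnd ℂ) (w' v x' y') =
          if x + y = Xc v then (if x' + y' = Xc v then sgn (tr (θ * Z v * (x + x'))) else 0)
            else 0 := by
        intro v
        simp only [w', Matrix.of_apply]
        split_ifs <;> simp [mul_add, sgn_add]
      simp only [h1]
      -- The sum over the `X`-coordinate has one surviving term; the sum over the `Z`-coordinate is
      -- a character sum, which vanishes unless `x = x'`.
      rw [← φ.symm.sum_comp, Fintype.sum_prod_type]
      have h2 : ∀ a b, Xc (φ.symm (a, b)) = a ∧ Z (φ.symm (a, b)) = b := by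
        intro a b
        have := φ.apply_symm_apply (a, b)
        exact ⟨congrArg Prod.fst this, congrArg Prod.snd this⟩
      simp only [(h2 _ _).1, (h2 _ _).2]
      rw [Finset.sum_eq_single (x + y)]
      · simp only [if_true]
        by_cases h : x = x'
        · subst h
          by_cases hy : y = y'
          · subst hy
            simp [CharTwo.add_self_eq_zero, hBcard]
          · have : x + y' ≠ x + y := fun h => hy (add_left_cancel h).symm
            simp [this, hy]
        · rw [if_neg (fun h' => h h'.1)]
          split_ifs with h3
          · have hd : (x : F) + x' ≠ 0 := by
              intro h4
              apply h
              exact Subtype.ext (CharTwo.add_eq_zero.1 h4)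
            obtain ⟨y0, hy0⟩ := exists_trace_mul_ne_zero hd
            have hbb : tr (θ * Z y0 * (x + x')) ≠ 0 := by
              rw [hXZ y0, add_mul, map_add, htrB _ (mul_mem_fixedPow (Xc y0).2 (B.add_mem x.2 x'.2)),
                zero_add] at hy0
              exact hy0
            refine sum_sgn_eq_zero (fun b : B => tr (θ * b * (x + x'))) (fun b b' => ?_) hbb
            rw [← map_add]
            congr 1
            push_cast
            ring
          · simp
      · intro a _ ha
        simp [Ne.symm ha]
      · simp
    have := key (ε x) (ε y) (ε x') (ε y')
    simpa using this

end Qudit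

end EAQ

namespace EAQ

open Module

/-! ### Pauli expansion of local errors; the trace-Hermitian form -/

section Hermitian

variable {F : Type*} [Field F] {e n : ℕ}

/-- An error on the qudits in `T` is a linear combination of Pauli operators on these qudits. -/
lemma exists_pauli_expansion [Fintype F] {X : Type*} [Fintype X] [DecidableEq X] {w : F → Matrix X X ℂ}
    {Q : ℂ} (hQ : Q ≠ 0) (h0 : w 0 = 1)
    (hw : ∀ x y x' y', ∑ v, w v x y * (starRingEnd ℂ) (w v x' y') =
      if x = x' ∧ y = y' then Q else 0) (T : Finset (Fin n))
    (A : Matrix (T → X) (T → X) ℂ) :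
    ∃ (a : (T → F) → ℂ), ∀ x y : Fin n → X,
      ∑ v, a v * tens (fun i => w (if h : i ∈ T then v ⟨i, h⟩ else 0)) x y =
        if ∀ i ∉ T, x i = y i then A (fun i => x i) (fun i => y i) else 0 := by
  classical
  have hsplit : ∀ (v : T → F) (x y : Fin n → X),
      tens (fun i => w (if h : i ∈ T then v ⟨i, h⟩ else 0)) x y =
        (∏ i : T, w (v i) (x i) (y i)) * if ∀ i ∉ T, x i = y i then 1 else 0 := by
    intro v x y
    simp only [tens, Matrix.of_apply]
    rw [← Finset.prod_mul_prod_compl T]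
    congr 1
    · rw [← Finset.prod_coe_sort]
      refine Finset.prod_congr rfl fun i _ => ?_
      simp
    · have : ∀ i ∈ Tᶜ, w (if h : i ∈ T then v ⟨i, h⟩ else 0) (x i) (y i) =
          if x i = y i then 1 else 0 := by
        intro i hi
        rw [dif_neg (Finset.mem_compl.1 hi), h0, Matrix.one_apply]
      rw [Finset.prod_congr rfl this, Finset.prod_ite_zero]
      simp
  have hcomp : ∀ x y x' y' : T → X, ∑ v : T → F, (∏ i, w (v i) (x i) (y i)) *
      (starRingEnd ℂ) (∏ i, w (v i) (x' i) (y' i)) =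
      if x = x' ∧ y = y' then Q ^ Fintype.card T else 0 := by
    intro x y x' y'
    simp only [map_prod, ← Finset.prod_mul_distrib]
    have h := Finset.prod_univ_sum (fun _ : T => (Finset.univ : Finset F))
      (fun i v => w v (x i) (y i) * (starRingEnd ℂ) (w v (x' i) (y' i)))
    rw [Fintype.piFinset_univ] at h
    rw [← h]
    simp only [hw]
    rw [Fintype.prod_ite_zero]
    simp only [Finset.prod_const, Finset.card_univ, funext_iff, forall_and]
  -- The coefficients are normalized Hilbert–Schmidt products of `A` with the Pauli operators on
  -- `T`.
  refine ⟨fun v => (Q ^ Fintype.card T)⁻¹ * ∑ x', ∑ y', A x' y' *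
    (starRingEnd ℂ) (∏ i, w (v i) (x' i) (y' i)), fun x y => ?_⟩
  simp only [hsplit, ← mul_assoc, ← Finset.sum_mul]
  rw [mul_ite, mul_one, mul_zero]
  congr 1
  have hQ' : Q ^ Fintype.card T ≠ 0 := pow_ne_zero _ hQ
  calc ∑ v : T → F, (Q ^ Fintype.card T)⁻¹ * (∑ x', ∑ y', A x' y' *
        (starRingEnd ℂ) (∏ i, w (v i) (x' i) (y' i))) * ∏ i : T, w (v i) (x i) (y i)
      = (Q ^ Fintype.card T)⁻¹ * ∑ x', ∑ y', A x' y' * ∑ v : T → F,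
          (∏ i, w (v i) (x i) (y i)) * (starRingEnd ℂ) (∏ i, w (v i) (x' i) (y' i)) := by
        simp only [Finset.mul_sum, Finset.sum_mul]
        rw [Finset.sum_comm]
        refine Finset.sum_congr rfl fun x' _ => ?_
        rw [Finset.sum_comm]
        refine Finset.sum_congr rfl fun y' _ => Finset.sum_congr rfl fun v _ => ?_
        ring
    _ = A (fun i => x i) (fun i => y i) := by
        simp only [hcomp, ite_and, mul_ite, mul_zero]
        rw [Finset.sum_comm]
        simp only [Finset.sum_ite_eq, Finset.mem_univ, if_true]
        field_simp

variable [CharP F 2]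

/-- The vectors that are orthogonal to `C` with respect to the Hermitian form. -/
def hermitianDual (e : ℕ) (C : Submodule F (Fin n → F)) :
    Submodule F (Fin n → F) where
  carrier := {v | ∀ c ∈ C, ∑ i, c i * v i ^ 2 ^ e = 0}
  zero_mem' := by simp
  add_mem' {v w} hv hw c hc := by
    simp only [Pi.add_apply, add_pow_two_pow, mul_add, Finset.sum_add_distrib, hv c hc, hw c hc,
      add_zero]
  smul_mem' a v hv c hc := by
    have : ∑ i, c i * (a • v) i ^ 2 ^ e = a ^ 2 ^ e * ∑ i, c i * v i ^ 2 ^ e := by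
      rw [Finset.mul_sum]
      refine Finset.sum_congr rfl fun i _ => ?_
      rw [Pi.smul_apply, smul_eq_mul, mul_pow]
      ring
    rw [this, hv c hc, mul_zero]

lemma mem_hermitianDual {C : Submodule F (Fin n → F)}
    {v : Fin n → F} : v ∈ hermitianDual e C ↔ ∀ c ∈ C, ∑ i, c i * v i ^ 2 ^ e = 0 := Iff.rfl

/-- The trace-Hermitian form `(u, v) ↦ tr (∑ uᵢ vᵢ ^ q)` on `F ^ n`. -/
noncomputable def traceForm (F : Type*) [Field F] [CharP F 2] [Algebra (ZMod 2) F] (e n : ℕ) :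
    LinearMap.BilinForm (ZMod 2) (Fin n → F) :=
  (AddMonoidHom.toZModLinearMap 2
    ((AddMonoidHom.mk' (fun u : Fin n → F => AddMonoidHom.toZModLinearMap 2
      (AddMonoidHom.mk' (fun v : Fin n → F =>
        Algebra.trace (ZMod 2) F (∑ i, u i * v i ^ 2 ^ e)) fun v w => by
          simp only [Pi.add_apply, add_pow_two_pow, mul_add, Finset.sum_add_distrib, map_add]))
      fun u v => by
        ext w
        simp [add_mul, Finset.sum_add_distrib])))

variable [Algebra (ZMod 2) F]

lemma traceForm_apply (u v : Fin n → F) :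
    traceForm F e n u v = Algebra.trace (ZMod 2) F (∑ i, u i * v i ^ 2 ^ e) := rfl

variable [Fintype F]

lemma traceForm_symm (hF : Fintype.card F = (2 ^ e) ^ 2) (u v : Fin n → F) :
    traceForm F e n u v = traceForm F e n v u := by
  rw [traceForm_apply, traceForm_apply, ← trace_pow_two_pow e]
  congr 1
  have : (∑ i, u i * v i ^ 2 ^ e) ^ 2 ^ e = ∑ i, (u i * v i ^ 2 ^ e) ^ 2 ^ e :=
    sum_pow_char_pow 2 e _ _
  rw [this]
  refine Finset.sum_congr rfl fun i _ => ?_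
  rw [mul_pow, pow_pow_two_pow hF, mul_comm]

/-- The Hermitian norm `∑ uᵢ uᵢ ^ q` is fixed by the `q`-power map, and the absolute trace vanishes
on such elements. -/
lemma traceForm_isAlt (he : 0 < e) (hF : Fintype.card F = (2 ^ e) ^ 2) :
    (traceForm F e n).IsAlt := by
  obtain ⟨θ, hθ⟩ := exists_add_pow_eq_one he hF
  intro u
  rw [traceForm_apply]
  set x := ∑ i, u i * u i ^ 2 ^ e with hx
  have hxB : x ^ 2 ^ e = x := by
    rw [hx, sum_pow_char_pow 2 e]
    refine Finset.sum_congr rfl fun i _ => ?_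
    rw [mul_pow, pow_pow_two_pow hF, mul_comm]
  have h1 : Algebra.trace (ZMod 2) F (θ * x + (θ * x) ^ 2 ^ e) = Algebra.trace (ZMod 2) F x := by
    rw [mul_pow, hxB, ← add_mul, hθ, one_mul]
  rw [← h1, map_add, trace_pow_two_pow, CharTwo.add_self_eq_zero]

lemma traceForm_nondegenerate (hF : Fintype.card F = (2 ^ e) ^ 2) :
    (traceForm F e n).Nondegenerate := by
  classical
  suffices hsep : ∀ v, (∀ u, traceForm F e n u v = 0) → v = 0 from
    ⟨fun v hv => hsep v fun u => by rw [traceForm_symm hF, hv], hsep⟩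
  intro v hv
  ext i
  by_contra hi
  obtain ⟨b, hb⟩ := exists_trace_mul_ne_zero (pow_ne_zero (2 ^ e) hi)
  apply hb
  have := hv (Pi.single i b)
  rw [traceForm_apply, Finset.sum_eq_single i] at this
  · simpa using this
  · intro j _ hj
    simp [hj]
  · simp

/-- Because `C` is `F`-linear, a nonzero Hermitian product with `c ∈ C` becomes one of nonzero trace
after scaling `c`. -/
lemma orthogonal_traceForm (C : Submodule F (Fin n → F)) :
    (traceForm F e n).orthogonal (C.restrictScalars (ZMod 2)) =
      (hermitianDual e C).restrictScalars (ZMod 2) := by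
  ext v
  constructor
  · intro hv c hc
    by_contra hne
    obtain ⟨b, hb⟩ := exists_trace_mul_ne_zero hne
    apply hb
    have h := hv (b • c) (C.smul_mem b hc)
    rw [traceForm_apply] at h
    rw [← h, Finset.mul_sum]
    congr 1
    refine Finset.sum_congr rfl fun i _ => ?_
    rw [Pi.smul_apply, smul_eq_mul, mul_assoc]
  · intro hv c hc
    rw [traceForm_apply, hv c hc, map_zero]

end Hermitian

end EAQ

namespace EAQ

open Module

/-! ### Entanglement-assisted codes from linear codes -/

section Hermitian

variable {F : Type*} [Field F] {e n : ℕ}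

lemma opOf_mul_apply {q : ℕ} (A B : Matrix (Fin n → Fin q) (Fin n → Fin q) ℂ) (x : Qudits q n) :
    opOf A (opOf B x) = opOf (A * B) x := by
  simp [opOf, Matrix.toLpLin_apply]

lemma inner_opOf {q : ℕ} (A : Matrix (Fin n → Fin q) (Fin n → Fin q) ℂ) (x y : Qudits q n) :
    inner ℂ (opOf A x) (opOf A y) = inner ℂ x (opOf (A.conjTranspose * A) y) := by
  rw [← opOf_mul_apply]
  simp only [opOf]
  rw [Matrix.toEuclideanLin_conjTranspose_eq_adjoint, LinearMap.adjoint_inner_right]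

lemma opOf_smul {q : ℕ} (a : ℂ) (A : Matrix (Fin n → Fin q) (Fin n → Fin q) ℂ) (x : Qudits q n) :
    opOf (a • A) x = a • opOf A x := by
  simp [opOf]

lemma opOf_one {q : ℕ} (x : Qudits q n) : opOf 1 x = x := by
  simp [opOf]

/-- Signs multiply over the tensor factors, so the one-qudit forms add up to `traceForm`. -/
lemma isWeylSystem_tens [CharP F 2] [Algebra (ZMod 2) F] {w : F → Matrix (Fin (2 ^ e)) (Fin (2 ^ e)) ℂ}
    {η : F → F → ZMod 2} (h0 : w 0 = 1)
    (hmul : ∀ u v, w u * w v = sgn (η u v) • w (u + v))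
    (hcomm : ∀ u v, w u * w v = sgn (Algebra.trace (ZMod 2) F (u * v ^ 2 ^ e)) • (w v * w u))
    (hconj : ∀ u, (w u).conjTranspose * w u = 1) :
    IsWeylSystem (traceForm F e n) fun v : Fin n → F => opOf (tens fun i => w (v i)) where
  zero x := by
    simp only [Pi.zero_apply, h0, tens_one, opOf_one]
  add u v := by
    refine ⟨∏ i, sgn (η (u i) (v i)), Finset.prod_ne_zero_iff.2 fun i _ => sgn_ne_zero _, fun x => ?_⟩
    simp only [opOf_mul_apply, tens_mul, hmul, tens_smul, opOf_smul, Pi.add_apply]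
  comm u v x := by
    rw [opOf_mul_apply, opOf_mul_apply, tens_mul, tens_mul, traceForm_apply, map_sum, sgn_sum,
      ← opOf_smul, ← tens_smul]
    simp only [hcomm (u _) (v _)]
  inner_map u x y := by
    rw [inner_opOf, tens_conjTranspose, tens_mul]
    simp only [hconj, tens_one, opOf_one]

lemma finrank_restrictScalars_zmod_two [Fintype F] [Algebra (ZMod 2) F]
    (hF : Fintype.card F = (2 ^ e) ^ 2)
    (C : Submodule F (Fin n → F)) :
    finrank (ZMod 2) (C.restrictScalars (ZMod 2)) = 2 * e * finrank F C := by
  have h1 : finrank (ZMod 2) F = 2 * e := by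
    have h := Module.card_eq_pow_finrank (K := ZMod 2) (V := F)
    rw [hF, ZMod.card, ← pow_mul, mul_comm e 2] at h
    exact (Nat.pow_right_injective le_rfl h).symm
  rw [← h1]
  exact (Module.finrank_mul_finrank (ZMod 2) F C).symm

/-- The entanglement-assisted quantum code of a linear code over the field with `q ^ 2` elements:
the errors that are not detected are those in `C` outside its Hermitian dual. -/
theorem existsCode_of_hermitianDual [Fintype F] [DecidableEq F] [CharP F 2] (he : 0 < e)
    (hF : Fintype.card F = (2 ^ e) ^ 2) (C : Submodule F (Fin n → F)) {k c d ρ : ℕ}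
    (hρ : finrank F (C ⊓ hermitianDual e C : Submodule F (Fin n → F)) = ρ)
    (hk : finrank F C = ρ + k) (hc : finrank F (hermitianDual e C) = ρ + c)
    (hmin : ∀ v ∈ C, v ≠ 0 → d ≤ hammingNorm v)
    (hex : ∃ v ∈ C, v ∉ hermitianDual e C ∧ hammingNorm v = d) : ExistsCode (2 ^ e) n k d c := by
  let _ : Algebra (ZMod 2) F := ZMod.algebra F 2
  obtain ⟨w, η, h0, hmul, hcomm, hconj, hcompl⟩ := exists_qudit_pauli he hF
  have hD := isWeylSystem_tens (n := n) h0 hmul hcomm hconj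
  have horth := orthogonal_traceForm (e := e) C
  -- Dimensions over `ZMod 2` are `2 e` times those over `F`, and `q ^ k = 2 ^ (e k)`; hence the
  -- parameters `e k`, `e c`, `2 e ρ`.
  obtain ⟨u, hu, hdet, hndet⟩ := hD.exists_code (traceForm_isAlt he hF)
    (traceForm_nondegenerate hF) (C.restrictScalars (ZMod 2))
    (κ₁ := Fin k → Fin (2 ^ e)) (κ₂ := Fin c → Fin (2 ^ e)) (k := e * k) (c := e * c)
    (ρ := 2 * e * ρ) (by simp [pow_mul]) (by simp [pow_mul])
    (by
      rw [horth, ← hρ]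
      exact finrank_restrictScalars_zmod_two hF (C ⊓ hermitianDual e C))
    (by rw [finrank_restrictScalars_zmod_two hF, hk]; ring)
    (by rw [horth, finrank_restrictScalars_zmod_two hF, hc]; ring)
  have hq : 0 < 2 ^ e := by positivity
  refine ⟨isometryOf u hu, fun T E hT hE => ?_, ?_⟩
  · rw [detects_iff hq]
    obtain ⟨A, hA⟩ := hE
    obtain ⟨a, ha⟩ := exists_pauli_expansion (n := n) (w := w) (Q := (2 ^ e : ℂ))
      (pow_ne_zero _ two_ne_zero)
      h0 hcompl T A
    let ext' : (T → F) → (Fin n → F) := fun v i => if h : i ∈ T then v ⟨i, h⟩ else 0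
    have hE' : E = ∑ v, a v • tens fun i => w (ext' v i) := by
      ext x y
      simp only [Matrix.sum_apply, Matrix.smul_apply, smul_eq_mul]
      rw [ha x y]
      split_ifs with h
      · exact (hA x y).1 h
      · push Not at h
        exact (hA x y).2 h
    -- A label supported on `T` has weight below `d`, so it lies in `C` only if it is zero.
    have hext : ∀ v, ext' v ∉ C.restrictScalars (ZMod 2) ∨ ext' v = 0 := by
      intro v
      by_contra! h
      have h1 := hmin _ h.1 h.2
      have h2 : hammingNorm (ext' v) ≤ T.card := by
        refine Finset.card_le_card fun i hi => ?_
        by_contra hiT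
        simp [ext', hiT] at hi
      omega
    choose z hz using fun v => hdet (ext' v) (hext v)
    refine ⟨∑ v, a v * z v, fun a₁ a₂ => ?_⟩
    have hlin : ∀ x, opOf E x = ∑ v, a v • opOf (tens fun i => w (ext' v i)) x := by
      intro x
      rw [hE']
      simp only [opOf, map_sum, map_smul, LinearMap.sum_apply, LinearMap.smul_apply]
    simp only [hlin, inner_sum, inner_smul_right]
    rw [Finset.sum_comm]
    simp only [← Finset.mul_sum, hz]
    split_ifs <;> simp
  · obtain ⟨v, hvC, hvS, hvd⟩ := hex
    refine ⟨Finset.univ.filter fun i => v i ≠ 0, tens fun i => w (v i), hvd, ?_, ?_⟩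
    · refine ⟨tens fun i => w (v i), fun x y => ⟨fun h => ?_, fun ⟨i, hi, hne⟩ => ?_⟩⟩
      · simp only [tens, Matrix.of_apply]
        rw [← Finset.prod_mul_prod_compl (Finset.univ.filter fun i => v i ≠ 0)]
        rw [Finset.prod_coe_sort _ (fun i => w (v i) (x i) (y i))]
        convert mul_one _ using 2
        refine Finset.prod_eq_one fun i hi => ?_
        rw [Finset.mem_compl] at hi
        have : v i = 0 := by simpa using hi
        rw [this, h0, h i hi, Matrix.one_apply_eq]
      · have : v i = 0 := by simpa using hi
        simp only [tens, Matrix.of_apply]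
        refine Finset.prod_eq_zero (Finset.mem_univ i) ?_
        rw [this, h0, Matrix.one_apply_ne hne]
    · rw [detects_iff hq]
      exact hndet v hvC (by rw [horth]; exact hvS)

end Hermitian

end EAQ

namespace Constacyclic

open Module Polynomial

/-! ### Linear algebra -/

section LinearAlgebra

/-- Each row of `B` is a functional vanishing on the common kernel of the rows of `A`, hence lies in
their span. -/
lemma exists_eq_mul_of_ker_le {L : Type*} [Field L] {m n : ℕ} {ι : Type*} (A : Matrix (Fin m) (Fin n) L)
    (B : Matrix ι (Fin n) L) (h : ∀ x, A.mulVec x = 0 → B.mulVec x = 0) :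
    ∃ D : Matrix ι (Fin m) L, B = D * A := by
  have key : ∀ j, ∃ d : Fin m → L, ∀ i, B j i = ∑ k, d k * A k i := by
    intro j
    let φ : Fin m → (Fin n → L) →ₗ[L] L := fun k => (LinearMap.proj k).comp A.mulVecLin
    let ψ : (Fin n → L) →ₗ[L] L := LinearMap.lsum L (fun _ => L) L fun i => LinearMap.toSpanSingleton L L (B j i)
    have hψ : ∀ x, ψ x = ∑ i, B j i * x i := by
      intro x
      simp [ψ, mul_comm]
    have hmem : ψ ∈ Submodule.span L (Set.range φ) := by
      apply mem_span_of_iInf_ker_le_ker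
      intro x hx
      rw [Submodule.mem_iInf] at hx
      have h1 : A.mulVec x = 0 := by
        ext k
        exact hx k
      have h2 := congrFun (h x h1) j
      rw [LinearMap.mem_ker, hψ]
      exact h2
    obtain ⟨d, hd⟩ := (Submodule.mem_span_range_iff_exists_fun L).1 hmem
    refine ⟨d, fun i => ?_⟩
    have h3 := LinearMap.congr_fun hd (Pi.single i 1)
    rw [hψ] at h3
    simpa [φ, Pi.single_apply] using h3.symm
  choose d hd using key
  refine ⟨Matrix.of d, ?_⟩
  ext j i
  rw [hd, Matrix.mul_apply]
  rfl

/-- Expand the entries of `x` in an `F`-basis of `K`: each coordinate vector is a word over `F`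
killed by `H`. -/
lemma mulVec_eq_zero_of_ker {F K : Type*} [Field F] [Field K] [Algebra F K] {m n : ℕ} {ι : Type*}
    (H : Matrix (Fin m) (Fin n) F) (V : Matrix ι (Fin n) K)
    (h : ∀ c, H.mulVec c = 0 → V.mulVec (fun i => algebraMap F K (c i)) = 0) (x : Fin n → K)
    (hx : (H.map (algebraMap F K)).mulVec x = 0) : V.mulVec x = 0 := by
  classical
  let b := Basis.ofVectorSpace F K
  let S := Finset.univ.biUnion fun i => (b.repr (x i)).support
  have hxi : ∀ i, x i = ∑ l ∈ S, algebraMap F K (b.repr (x i) l) * b l := by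
    intro i
    conv_lhs => rw [← b.linearCombination_repr (x i), Finsupp.linearCombination_apply, Finsupp.sum]
    simp only [Algebra.smul_def]
    refine Finset.sum_subset (Finset.subset_biUnion_of_mem (fun i => (b.repr (x i)).support)
      (Finset.mem_univ i)) fun l _ hl => ?_
    rw [Finsupp.notMem_support_iff.1 hl, map_zero, zero_mul]
  have hc : ∀ l, H.mulVec (fun i => b.repr (x i) l) = 0 := by
    intro l
    ext k
    have h1 := congrFun hx k
    simp only [Matrix.mulVec, dotProduct, Matrix.map_apply, Pi.zero_apply] at h1 ⊢
    have h2 := congrArg (fun y => b.repr y l) h1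
    simp only [← Algebra.smul_def, map_sum, map_smul, map_zero, Finsupp.coe_finsetSum,
      Finset.sum_apply, Finsupp.smul_apply, smul_eq_mul, Finsupp.zero_apply] at h2
    exact h2
  ext j
  have h3 : ∀ l, ∑ i, V j i * algebraMap F K (b.repr (x i) l) = 0 := fun l => congrFun (h _ (hc l)) j
  simp only [Matrix.mulVec, dotProduct, Pi.zero_apply]
  calc ∑ i, V j i * x i = ∑ i, ∑ l ∈ S, V j i * algebraMap F K (b.repr (x i) l) * b l := by
        refine Finset.sum_congr rfl fun i _ => ?_
        conv_lhs => rw [hxi i, Finset.mul_sum]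
        exact Finset.sum_congr rfl fun l _ => (mul_assoc _ _ _).symm
    _ = ∑ l ∈ S, (∑ i, V j i * algebraMap F K (b.repr (x i) l)) * b l := by
        rw [Finset.sum_comm]
        exact Finset.sum_congr rfl fun l _ => (Finset.sum_mul _ _ _).symm
    _ = 0 := by simp [h3]

/-- Transvections diagonalize `A`; their determinants stay 1 in the extension, and nonzero diagonal
entries stay nonzero. -/
lemma rank_map_algebraMap {F K : Type*} [Field F] [Field K] [Algebra F K] {m : ℕ}
    (A : Matrix (Fin m) (Fin m) F) : (A.map (algebraMap F K)).rank = A.rank := by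
  classical
  obtain ⟨L, L', D, h⟩ := Matrix.Pivot.exists_list_transvec_mul_diagonal_mul_list_transvec A
  have key : ∀ P Q : Matrix (Fin m) (Fin m) F, P.det = 1 → Q.det = 1 →
      A = P * Matrix.diagonal D * Q → (A.map (algebraMap F K)).rank = A.rank := by
    intro P Q hP hQ hA
    have hP' : (P.map (algebraMap F K)).det = 1 := by
      have := RingHom.map_det (algebraMap F K) P
      rw [hP, map_one] at this
      exact this.symm
    have hQ' : (Q.map (algebraMap F K)).det = 1 := by
      have := RingHom.map_det (algebraMap F K) Q
      rw [hQ, map_one] at this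
      exact this.symm
    rw [hA, Matrix.map_mul, Matrix.map_mul, Matrix.diagonal_map (map_zero _),
      Matrix.rank_mul_eq_left_of_isUnit_det _ _ (by rw [hQ']; exact isUnit_one),
      Matrix.rank_mul_eq_right_of_isUnit_det _ _ (by rw [hP']; exact isUnit_one),
      Matrix.rank_mul_eq_left_of_isUnit_det _ _ (by rw [hQ]; exact isUnit_one),
      Matrix.rank_mul_eq_right_of_isUnit_det _ _ (by rw [hP]; exact isUnit_one),
      Matrix.rank_diagonal, Matrix.rank_diagonal]
    refine Fintype.card_congr (Equiv.subtypeEquivRight fun i => ?_)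
    simp
  exact key _ _ (Matrix.TransvectionStruct.det_toMatrix_prod L)
    (Matrix.TransvectionStruct.det_toMatrix_prod L') h

/-- The rank of a matrix of zeros and ones with at most one `1` in each row and column. -/
lemma rank_of_partial_perm {K : Type*} [Field K] {M : ℕ} (R : Fin M → Fin M → Prop)
    [∀ i j, Decidable (R i j)] (h1 : ∀ i j j', R i j → R i j' → j = j')
    (h2 : ∀ i i' j, R i j → R i' j → i = i') :
    (Matrix.of fun i j => if R i j then (1 : K) else 0).rank = Nat.card {i // ∃ j, R i j} := by
  classical
  set P : Matrix (Fin M) (Fin M) K := Matrix.of fun i j => if R i j then (1 : K) else 0 with hP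
  let d : Fin M → K := fun i => if ∃ j, R i j then 1 else 0
  -- `P Pᵀ` is the diagonal indicator of the nonzero rows and fixes `P` from the left, so each rank
  -- bounds the other.
  have hPP : P * P.transpose = Matrix.diagonal d := by
    ext i i'
    simp only [hP, Matrix.mul_apply, Matrix.transpose_apply, Matrix.of_apply, Matrix.diagonal_apply,
      ite_mul, one_mul, zero_mul]
    by_cases hi : ∃ j, R i j
    · obtain ⟨j, hj⟩ := hi
      rw [Finset.sum_eq_single j]
      · rw [if_pos hj]
        by_cases hii : i = i'
        · subst hii
          rw [if_pos hj, if_pos rfl]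
          exact (if_pos ⟨j, hj⟩).symm
        · rw [if_neg hii, if_neg fun h => hii (h2 _ _ _ hj h)]
      · intro j' _ hne
        rw [if_neg fun h => hne (h1 _ _ _ h hj)]
      · simp
    · rw [Finset.sum_eq_zero]
      · split_ifs
        · exact (if_neg hi).symm
        · rfl
      · intro j _
        rw [if_neg fun h => hi ⟨j, h⟩]
  have hdP : Matrix.diagonal d * P = P := by
    ext i j
    rw [Matrix.diagonal_mul]
    simp only [hP, Matrix.of_apply, d]
    by_cases hij : R i j
    · rw [if_pos hij, if_pos ⟨j, hij⟩, one_mul]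
    · rw [if_neg hij, mul_zero]
  have hle : P.rank ≤ (Matrix.diagonal d).rank := by
    conv_lhs => rw [← hdP]
    exact Matrix.rank_mul_le_left _ _
  have hge : (Matrix.diagonal d).rank ≤ P.rank := by
    rw [← hPP]
    exact Matrix.rank_mul_le_left _ _
  rw [le_antisymm hle hge, Matrix.rank_diagonal, Nat.card_eq_fintype_card]
  refine Fintype.card_congr (Equiv.subtypeEquivRight fun i => ?_)
  simp [d]

lemma exists_parityCheck {F : Type*} [Field F] {n M : ℕ} (C : Submodule F (Fin n → F))
    (hC : finrank F C + M = n) : ∃ H : Matrix (Fin M) (Fin n) F, IsParityCheck H C := by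
  have h := Submodule.finrank_quotient_add_finrank C
  rw [Module.finrank_fin_fun] at h
  have ε : ((Fin n → F) ⧸ C) ≃ₗ[F] (Fin M → F) :=
    LinearEquiv.ofFinrankEq _ _ (by rw [Module.finrank_fin_fun]; omega)
  refine ⟨LinearMap.toMatrix' (ε.toLinearMap.comp C.mkQ), fun c => ?_⟩
  rw [LinearMap.toMatrix'_mulVec, LinearMap.comp_apply]
  simp

end LinearAlgebra

end Constacyclic

namespace Constacyclic

open Module Polynomial

/-! ### Dimension and minimum distance of constacyclic codes -/

section Code

variable {F K : Type*} [Field F] [Field K] [Algebra F K] {r n : ℕ} {δ : K} {α : F}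

lemma X_pow_sub_C_eq_prod_pow (hδ : IsPrimitiveRoot δ (r * n)) (hr : 0 < r) (hn : 0 < n) :
    (X ^ n - Polynomial.C (δ ^ n) : K[X]) =
      ∏ j ∈ Finset.range n, (X - Polynomial.C (δ ^ (1 + r * j))) := by
  have hζ : IsPrimitiveRoot (δ ^ r) n := hδ.pow (Nat.mul_pos hr hn) rfl
  rw [X_pow_sub_C_eq_prod hζ hn (α := δ) rfl]
  refine Finset.prod_congr rfl fun j _ => ?_
  rw [← pow_mul, ← pow_succ, add_comm]

lemma pow_one_add_mul_injOn (hδ : IsPrimitiveRoot δ (r * n)) (hr : 0 < r) (hn : 0 < n) {i j : ℕ}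
    (hi : i < n) (hj : j < n) (h : δ ^ (1 + r * i) = δ ^ (1 + r * j)) : i = j := by
  have hζ : IsPrimitiveRoot (δ ^ r) n := hδ.pow (Nat.mul_pos hr hn) rfl
  have h0 : δ ≠ 0 := hδ.ne_zero (Nat.mul_pos hr hn).ne'
  rw [pow_add, pow_add, pow_one, pow_mul, pow_mul] at h
  exact hζ.pow_inj hi hj (mul_left_cancel₀ h0 h)

/-- `X ^ n - α` splits over `K` with distinct roots, and so does its divisor `g`. -/
lemma natDegree_eq_card_of_roots (hδ : IsPrimitiveRoot δ (r * n)) (hr : 0 < r) (hn : 0 < n)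
    (hδα : δ ^ n = algebraMap F K α) {g : F[X]} (hg : g.Monic)
    (hdvd : g ∣ X ^ n - Polynomial.C α) {J : Finset ℕ} (hJn : ∀ j ∈ J, j < n)
    (hJ : ∀ j < n, aeval (δ ^ (1 + r * j)) g = 0 ↔ j ∈ J) : g.natDegree = J.card := by
  classical
  set G := g.map (algebraMap F K) with hG
  set P : K[X] := ∏ j ∈ Finset.range n, (X - Polynomial.C (δ ^ (1 + r * j))) with hP
  have hGP : G ∣ P := by
    have := Polynomial.map_dvd (algebraMap F K) hdvd
    rwa [Polynomial.map_sub, Polynomial.map_pow, map_X, map_C, ← hδα,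
      X_pow_sub_C_eq_prod_pow hδ hr hn] at this
  have hP0 : P ≠ 0 := Finset.prod_ne_zero_iff.2 fun j _ => X_sub_C_ne_zero _
  have hPr : P.roots = (Finset.range n).val.map fun j => δ ^ (1 + r * j) := by
    have h := Multiset.map_map (fun a => X - Polynomial.C a) (fun j => δ ^ (1 + r * j))
      (Finset.range n).val
    rw [hP, Finset.prod_eq_multiset_prod]
    change (Multiset.map ((fun a => X - Polynomial.C a) ∘ fun j => δ ^ (1 + r * j)) _).prod.roots = _
    rw [← h]
    exact roots_multiset_prod_X_sub_C _
  have hPs : P.Splits := Splits.prod fun j _ => Splits.X_sub_C _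
  have hGs : G.Splits := hPs.of_dvd hP0 hGP
  have hnd : G.roots.Nodup := by
    refine Multiset.nodup_of_le (roots.le_of_dvd hP0 hGP) ?_
    rw [hPr]
    refine Multiset.Nodup.map_on (fun i hi j hj h => ?_) (Finset.range n).nodup
    exact pow_one_add_mul_injOn hδ hr hn (Finset.mem_range.1 hi) (Finset.mem_range.1 hj) h
  have hG0 : G ≠ 0 := (hg.map _).ne_zero
  have hset : G.roots.toFinset = J.image fun j => δ ^ (1 + r * j) := by
    ext x
    rw [Multiset.mem_toFinset, mem_roots hG0, Finset.mem_image]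
    constructor
    · intro hx
      have hxP : x ∈ P.roots := (mem_roots hP0).2 (hx.dvd hGP)
      rw [hPr, Multiset.mem_map] at hxP
      obtain ⟨j, hj, rfl⟩ := hxP
      refine ⟨j, (hJ j (Finset.mem_range.1 hj)).1 ?_, rfl⟩
      rwa [IsRoot, hG, eval_map_algebraMap] at hx
    · rintro ⟨j, hj, rfl⟩
      rw [IsRoot, hG, eval_map_algebraMap]
      exact (hJ j (hJn j hj)).2 hj
  have h1 : g.natDegree = G.natDegree := (natDegree_map _).symm
  rw [h1, hGs.natDegree_eq_card_roots, ← Multiset.toFinset_card_of_nodup hnd, hset,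
    Finset.card_image_of_injOn]
  intro i hi j hj h
  exact pow_one_add_mul_injOn hδ hr hn (hJn i hi) (hJn j hj) h

lemma aeval_wordPoly (c : Fin n → F) (x : K) :
    aeval x (wordPoly c) = ∑ i : Fin n, algebraMap F K (c i) * x ^ (i : ℕ) := by
  simp [wordPoly]

/-- `wordPoly` as a linear map. -/
noncomputable def wordLin (F : Type*) [Field F] (n : ℕ) : (Fin n → F) →ₗ[F] F[X] where
  toFun := wordPoly
  map_add' c d := by simp [wordPoly, add_mul, Finset.sum_add_distrib]
  map_smul' a c := by
    simp [wordPoly, smul_eq_C_mul, Finset.mul_sum, mul_assoc]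

lemma wordPoly_coeff {p : F[X]} (hp : p.natDegree < n) :
    wordPoly (fun i : Fin n => p.coeff i) = p := by
  conv_rhs => rw [p.as_sum_range' n hp, Finset.sum_range]
  exact Finset.sum_congr rfl fun i _ => C_mul_X_pow_eq_monomial

/-- `C` is the kernel of the map from words to `F[X] / (g)`, which is onto because remainders modulo
`g` have degree below `n`. -/
lemma finrank_of_isGenerator {g : F[X]} {C : Submodule F (Fin n → F)}
    (hg : IsGenerator α g C) (hgn : g.natDegree < n) : finrank F C + g.natDegree = n := by
  have hg0 : g ≠ 0 := hg.1.ne_zero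
  let φ : (Fin n → F) →ₗ[F] AdjoinRoot g := (AdjoinRoot.mkₐ g).toLinearMap.comp (wordLin F n)
  have hker : LinearMap.ker φ = C := by
    ext c
    rw [hg.2.2, LinearMap.mem_ker]
    exact AdjoinRoot.mk_eq_zero
  have hrange : LinearMap.range φ = ⊤ := by
    rw [LinearMap.range_eq_top]
    intro y
    obtain ⟨p, rfl⟩ := AdjoinRoot.mk_surjective y
    have hdeg : (p %ₘ g).natDegree < n := by
      by_cases h1 : g = 1
      · rw [h1, modByMonic_one, natDegree_zero]
        omega
      · exact (natDegree_modByMonic_lt p hg.1 h1).trans hgn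
    refine ⟨fun i => (p %ₘ g).coeff i, ?_⟩
    change AdjoinRoot.mk g (wordPoly _) = _
    rw [wordPoly_coeff hdeg, AdjoinRoot.mk_eq_mk]
    have := modByMonic_add_div p g
    exact ⟨-(p /ₘ g), by linear_combination this⟩
  have h := LinearMap.finrank_range_add_finrank_ker φ
  rw [hker, hrange, finrank_top, Module.finrank_fin_fun,
    (AdjoinRoot.powerBasis hg0).finrank, AdjoinRoot.powerBasis_dim] at h
  omega

/-- The BCH bound. -/
lemma lt_hammingNorm_of_roots [DecidableEq F] (hδ : IsPrimitiveRoot δ (r * n)) (hr : 0 < r)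
    (hn : 0 < n) {h M : ℕ} {c : Fin n → F} (hc0 : c ≠ 0)
    (hc : ∀ i < M, ∑ j : Fin n, algebraMap F K (c j) * (δ ^ (1 + r * (h + i))) ^ (j : ℕ) = 0) :
    M < hammingNorm c := by
  have hζ : IsPrimitiveRoot (δ ^ r) n := hδ.pow (Nat.mul_pos hr hn) rfl
  have h0 : δ ≠ 0 := hδ.ne_zero (Nat.mul_pos hr hn).ne'
  by_contra! hle
  let T : Finset (Fin n) := Finset.univ.filter fun j => c j ≠ 0
  have hT : T.card ≤ M := hle
  let σ : Fin T.card ≃ T := T.equivFin.symm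
  let f : Fin T.card → K := fun k => (δ ^ r) ^ ((σ k : Fin n) : ℕ)
  let v : Fin T.card → K := fun k =>
    algebraMap F K (c (σ k)) * (δ ^ (1 + r * h)) ^ ((σ k : Fin n) : ℕ)
  have hf : Function.Injective f := by
    intro k l hkl
    have := hζ.pow_inj (σ k : Fin n).2 (σ l : Fin n).2 hkl
    exact σ.injective (Subtype.ext (Fin.ext this))
  -- On the support of `c` the equations form a Vandermonde system with distinct nodes `δ ^ (r j)`
  -- and at least as many equations as unknowns.
  have hv : v = 0 := by
    refine Matrix.eq_zero_of_forall_pow_sum_mul_pow_eq_zero hf fun i => ?_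
    rw [← hc i (by omega)]
    rw [σ.sum_comp (fun j : T => algebraMap F K (c j) * (δ ^ (1 + r * h)) ^ ((j : Fin n) : ℕ) *
      ((δ ^ r) ^ ((j : Fin n) : ℕ)) ^ (i : ℕ)), Finset.sum_coe_sort T (fun j : Fin n =>
      algebraMap F K (c j) * (δ ^ (1 + r * h)) ^ (j : ℕ) * ((δ ^ r) ^ (j : ℕ)) ^ (i : ℕ))]
    rw [← Finset.sum_subset (Finset.subset_univ T)]
    · refine Finset.sum_congr rfl fun j _ => ?_
      ring
    · intro j _ hj
      have : c j = 0 := by simpa [T] using hj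
      rw [this, map_zero, zero_mul]
  apply hc0
  ext j
  by_contra hj
  have hjT : j ∈ T := by simpa [T] using hj
  have h1 := congrFun hv (σ.symm ⟨j, hjT⟩)
  simp only [v, Equiv.apply_symm_apply, Pi.zero_apply, mul_eq_zero, map_eq_zero] at h1
  rcases h1 with h1 | h1
  · exact hj h1
  · exact pow_ne_zero _ (pow_ne_zero _ h0) h1

/-- All `deg g` roots are consecutive, so the BCH bound is `deg g + 1`; `g` itself has at most that
many coefficients. -/
lemma hasMinDistance_of_isGenerator [DecidableEq F] (hδ : IsPrimitiveRoot δ (r * n)) (hr : 0 < r)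
    {g : F[X]} {C : Submodule F (Fin n → F)} (hg : IsGenerator α g C) {h : ℕ}
    (hgn : g.natDegree < n)
    (hJ : ∀ i < g.natDegree, aeval (δ ^ (1 + r * (h + i))) g = 0) :
    HasMinDistance C (g.natDegree + 1) ∧ (fun i : Fin n => g.coeff i) ∈ C ∧
      (fun i : Fin n => g.coeff i) ≠ 0 ∧
      hammingNorm (fun i : Fin n => g.coeff i) = g.natDegree + 1 := by
  have hlow : ∀ c ∈ C, c ≠ 0 → g.natDegree + 1 ≤ hammingNorm c := by
    intro c hc hc0
    refine lt_hammingNorm_of_roots hδ hr (by omega) (h := h) hc0 fun i hi => ?_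
    rw [← aeval_wordPoly]
    obtain ⟨p, hp⟩ := (hg.2.2 c).1 hc
    rw [hp, map_mul, hJ i hi, zero_mul]
  have hmem : (fun i : Fin n => g.coeff i) ∈ C := by
    rw [hg.2.2, wordPoly_coeff hgn]
  have hne : (fun i : Fin n => g.coeff i) ≠ 0 := by
    intro h0
    have h1 := wordPoly_coeff hgn
    rw [h0] at h1
    apply hg.1.ne_zero
    rw [← h1]
    simp [wordPoly]
  have hle : hammingNorm (fun i : Fin n => g.coeff i) ≤ g.natDegree + 1 := by
    unfold hammingNorm
    have : ((Finset.univ.filter fun i : Fin n => g.coeff i ≠ 0).map Fin.valEmbedding) ⊆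
        Finset.range (g.natDegree + 1) := by
      intro i hi
      obtain ⟨j, hj, rfl⟩ := Finset.mem_map.1 hi
      have hj' : g.coeff j ≠ 0 := by simpa using hj
      exact Finset.mem_range.2 (Nat.lt_succ_of_le (le_natDegree_of_ne_zero hj'))
    have := Finset.card_le_card this
    rwa [Finset.card_map, Finset.card_range] at this
  have heq := le_antisymm hle (hlow _ hmem hne)
  refine ⟨⟨⟨_, hmem, hne, heq⟩, ?_⟩, hmem, hne, heq⟩
  rintro w ⟨c, hc, hc0, rfl⟩
  exact hlow c hc hc0

end Code

end Constacyclic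

namespace Constacyclic

open Module Polynomial EAQ

/-! ### The Hermitian dual of an MDS code -/

section MDS

variable {F : Type*} [Field F] {n M : ℕ}

lemma conj_mulVec_conjTranspose [Fintype F] [CharP F 2] {e : ℕ} (hF : Fintype.card F = (2 ^ e) ^ 2) (H : Matrix (Fin M) (Fin n) F)
    (y : Fin M → F) (i : Fin n) : ((conjTranspose (2 ^ e) H).mulVec y i) ^ 2 ^ e =
      Matrix.vecMul (fun k => y k ^ 2 ^ e) H i := by
  simp only [Matrix.mulVec, Matrix.vecMul, dotProduct, conjTranspose, Matrix.map_apply,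
    Matrix.transpose_apply]
  rw [sum_pow_char_pow 2 e]
  refine Finset.sum_congr rfl fun k _ => ?_
  rw [mul_pow, pow_pow_two_pow hF, mul_comm]

/-- Functionals vanishing on `C` are combinations of the rows of `H`; conjugation, being an
involution, turns them into combinations of the columns of `H*`. -/
lemma mem_hermitianDual_iff [Fintype F] [CharP F 2] {e : ℕ}
    {C : Submodule F (Fin n → F)} (hF : Fintype.card F = (2 ^ e) ^ 2) {H : Matrix (Fin M) (Fin n) F}
    (hH : IsParityCheck H C) (v : Fin n → F) :
    v ∈ hermitianDual e C ↔ ∃ y, (conjTranspose (2 ^ e) H).mulVec y = v := by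
  constructor
  · intro hv
    obtain ⟨D, hD⟩ := exists_eq_mul_of_ker_le H (Matrix.of fun (_ : Unit) i => v i ^ 2 ^ e)
      (fun c hc => by
        ext
        simp only [Matrix.mulVec, dotProduct, Matrix.of_apply, Pi.zero_apply]
        rw [← mem_hermitianDual.1 hv c ((hH c).2 hc)]
        exact Finset.sum_congr rfl fun i _ => mul_comm _ _)
    refine ⟨fun k => D () k ^ 2 ^ e, ?_⟩
    ext i
    have h1 := congrFun (congrFun hD ()) i
    rw [Matrix.of_apply, Matrix.mul_apply] at h1
    rw [← pow_pow_two_pow hF (v i), h1, sum_pow_char_pow 2 e]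
    simp only [Matrix.mulVec, dotProduct, conjTranspose, Matrix.map_apply, Matrix.transpose_apply]
    refine Finset.sum_congr rfl fun k _ => ?_
    rw [mul_pow, mul_comm]
  · rintro ⟨y, rfl⟩ c hc
    simp only [conj_mulVec_conjTranspose hF]
    have h1 : ∑ i, c i * Matrix.vecMul (fun k => y k ^ 2 ^ e) H i =
        (fun k => y k ^ 2 ^ e) ⬝ᵥ H.mulVec c := by
      rw [Matrix.dotProduct_mulVec, dotProduct_comm]
      rfl
    rw [h1, (hH c).1 hc, dotProduct_zero]

variable [DecidableEq F] {C : Submodule F (Fin n → F)}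

/-- For a code of minimum distance greater than `M`, any `M` columns of a parity check matrix with
`M` rows are independent. -/
lemma det_submatrix_ne_zero (hmin : ∀ c ∈ C, c ≠ 0 → M < hammingNorm c)
    {H : Matrix (Fin M) (Fin n) F} (hH : IsParityCheck H C) {J : Fin M → Fin n}
    (hJ : Function.Injective J) : (H.submatrix id J).det ≠ 0 := by
  intro hdet
  obtain ⟨v, hv0, hv⟩ := Matrix.exists_mulVec_eq_zero_iff.2 hdet
  let c : Fin n → F := fun i => ∑ k, if J k = i then v k else 0
  have hcJ : ∀ k, c (J k) = v k := by
    intro k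
    simp only [c, hJ.eq_iff, Finset.sum_ite_eq', Finset.mem_univ, if_true]
  have hc0 : c ≠ 0 := by
    intro h
    apply hv0
    ext k
    rw [← hcJ, h]
    rfl
  have hcC : c ∈ C := by
    rw [hH, ← hv]
    ext l
    simp only [Matrix.mulVec, dotProduct, c, Matrix.submatrix_apply, id_eq, Finset.mul_sum]
    rw [Finset.sum_comm]
    simp
  have hle : hammingNorm c ≤ M := by
    have : (Finset.univ.filter fun i => c i ≠ 0) ⊆ Finset.univ.image J := by
      intro i hi
      by_contra hiJ
      apply (Finset.mem_filter.1 hi).2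
      refine Finset.sum_eq_zero fun k _ => if_neg fun h => hiJ ?_
      exact Finset.mem_image.2 ⟨k, Finset.mem_univ _, h⟩
    calc hammingNorm c ≤ (Finset.univ.image J).card := Finset.card_le_card this
      _ ≤ (Finset.univ : Finset (Fin M)).card := Finset.card_image_le
      _ = M := by simp
  exact absurd (hmin c hcC hc0) (by omega)

lemma vecMul_eq_zero (hmin : ∀ c ∈ C, c ≠ 0 → M < hammingNorm c)
    {H : Matrix (Fin M) (Fin n) F} (hH : IsParityCheck H C) {J : Fin M → Fin n}
    (hJ : Function.Injective J) {y : Fin M → F} (hy : ∀ k, Matrix.vecMul y H (J k) = 0) : y = 0 := by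
  refine Matrix.eq_zero_of_vecMul_eq_zero (det_submatrix_ne_zero hmin hH hJ) ?_
  ext k
  exact hy k

variable [Fintype F] [CharP F 2] {e : ℕ}

lemma mulVec_conjTranspose_injective (hF : Fintype.card F = (2 ^ e) ^ 2) (hMn : M ≤ n)
    (hmin : ∀ c ∈ C, c ≠ 0 → M < hammingNorm c)
    {H : Matrix (Fin M) (Fin n) F} (hH : IsParityCheck H C) :
    Function.Injective (conjTranspose (2 ^ e) H).mulVecLin := by
  rw [← LinearMap.ker_eq_bot, LinearMap.ker_eq_bot']
  intro y hy
  have h1 : (fun k => y k ^ 2 ^ e) = 0 := by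
    refine vecMul_eq_zero hmin hH (Fin.castLE_injective hMn) fun k => ?_
    rw [← conj_mulVec_conjTranspose hF]
    have := congrFun hy (Fin.castLE hMn k)
    rw [Matrix.mulVecLin_apply] at this
    rw [this]
    simp
  ext k
  have h2 := congrFun h1 k
  exact pow_eq_zero_iff (by positivity) |>.1 h2

lemma finrank_hermitianDual (hF : Fintype.card F = (2 ^ e) ^ 2) (hMn : M ≤ n)
    (hmin : ∀ c ∈ C, c ≠ 0 → M < hammingNorm c)
    {H : Matrix (Fin M) (Fin n) F} (hH : IsParityCheck H C) :
    finrank F (hermitianDual e C) = M := by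
  have h : hermitianDual e C = LinearMap.range (conjTranspose (2 ^ e) H).mulVecLin := by
    ext v
    rw [mem_hermitianDual_iff hF hH]
    rfl
  rw [h, LinearMap.finrank_range_of_inj (mulVec_conjTranspose_injective hF hMn hmin hH),
    Module.finrank_fin_fun]

/-- `H*` is injective and maps the kernel of `H H*` onto the hull `C ⊓ hermitianDual e C`; then
rank-nullity applies. -/
lemma finrank_inf_hermitianDual (hF : Fintype.card F = (2 ^ e) ^ 2) (hMn : M ≤ n)
    (hmin : ∀ c ∈ C, c ≠ 0 → M < hammingNorm c)
    {H : Matrix (Fin M) (Fin n) F} (hH : IsParityCheck H C) :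
    finrank F (C ⊓ hermitianDual e C : Submodule F (Fin n → F)) +
      (H * conjTranspose (2 ^ e) H).rank = M := by
  have h : C ⊓ hermitianDual e C = (LinearMap.ker (H * conjTranspose (2 ^ e) H).mulVecLin).map
      (conjTranspose (2 ^ e) H).mulVecLin := by
    ext v
    rw [Submodule.mem_inf, mem_hermitianDual_iff hF hH, Submodule.mem_map]
    constructor
    · rintro ⟨hv, y, rfl⟩
      refine ⟨y, ?_, rfl⟩
      rw [LinearMap.mem_ker, Matrix.mulVecLin_apply, ← Matrix.mulVec_mulVec]
      exact (hH _).1 hv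
    · rintro ⟨y, hy, rfl⟩
      rw [LinearMap.mem_ker, Matrix.mulVecLin_apply, ← Matrix.mulVec_mulVec] at hy
      exact ⟨(hH _).2 hy, y, rfl⟩
  have h2 := LinearMap.finrank_range_add_finrank_ker (H * conjTranspose (2 ^ e) H).mulVecLin
  rw [Module.finrank_fin_fun] at h2
  rw [h, ← (Submodule.equivMapOfInjective _ (mulVec_conjTranspose_injective hF hMn hmin hH) _).finrank_eq,
    Matrix.rank]
  omega

/-- The word is `H* y`, and any `M` columns of `H` are independent, so `M` zeros force `y = 0`: the
dual is MDS as well. -/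
lemma eq_zero_of_mem_hermitianDual (hF : Fintype.card F = (2 ^ e) ^ 2)
    (hmin : ∀ c ∈ C, c ≠ 0 → M < hammingNorm c)
    {H : Matrix (Fin M) (Fin n) F} (hH : IsParityCheck H C) {J : Fin M → Fin n}
    (hJ : Function.Injective J) {v : Fin n → F} (hv : v ∈ hermitianDual e C)
    (hvJ : ∀ k, v (J k) = 0) : v = 0 := by
  obtain ⟨y, rfl⟩ := (mem_hermitianDual_iff hF hH v).1 hv
  have h1 : (fun k => y k ^ 2 ^ e) = 0 := by
    refine vecMul_eq_zero hmin hH hJ fun k => ?_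
    rw [← conj_mulVec_conjTranspose hF, hvJ]
    simp
  have h2 : y = 0 := by
    ext k
    exact pow_eq_zero_iff (by positivity) |>.1 (congrFun h1 k)
  rw [h2, Matrix.mulVec_zero]

end MDS

/-! ### The rank of `H H*` -/

section Rank

variable {F K : Type*} [Field F] [Field K] [Algebra F K] [CharP F 2] {r n e : ℕ} {δ : K} {α : F}

/-- The rank of `H H*` counts the pairs of roots of the generator that are conjugate inverses. -/
theorem rank_mul_conjTranspose (hδ : IsPrimitiveRoot δ (r * n)) (hr : r = 2 ^ e + 1) (hn : 0 < n)
    {g : F[X]} {C : Submodule F (Fin n → F)} (hg : IsGenerator α g C) {h M : ℕ} (hhM : h + M ≤ n)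
    (hJ : ∀ i < M, aeval (δ ^ (1 + r * (h + i))) g = 0)
    {H : Matrix (Fin M) (Fin n) F} (hH : IsParityCheck H C) :
    (H * conjTranspose (2 ^ e) H).rank = Nat.card {i : Fin M // ∃ j : Fin M,
      r * n ∣ (1 + r * (h + i)) + 2 ^ e * (1 + r * (h + j))} := by
  classical
  have hr0 : 0 < r := hr ▸ Nat.succ_pos _
  have : CharP K 2 := charP_of_injective_algebraMap (algebraMap F K).injective 2
  let ρ : Fin M → K := fun i => δ ^ (1 + r * (h + i))
  have hρinj : Function.Injective ρ := by
    intro i j hij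
    have hi := i.isLt
    have hj := j.isLt
    have := pow_one_add_mul_injOn hδ hr0 hn (i := h + i) (j := h + j) (by omega)
      (by omega) hij
    exact Fin.ext (by omega)
  let V : Matrix (Fin M) (Fin n) K := Matrix.of fun j i => ρ j ^ (i : ℕ)
  have hVrank : V.rank = M := by
    have hli : LinearIndependent K V.row := by
      rw [Fintype.linearIndependent_iff]
      intro a ha
      have h0 : a = 0 := by
        refine Matrix.eq_zero_of_forall_pow_sum_mul_pow_eq_zero hρinj fun i => ?_
        have := congrFun ha ⟨i, by have := i.isLt; omega⟩
        simpa [V, Matrix.row] using this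
      exact fun i => congrFun h0 i
    rw [hli.rank_matrix, Fintype.card_fin]
  have hker : ∀ x, (H.map (algebraMap F K)).mulVec x = 0 → V.mulVec x = 0 := by
    apply mulVec_eq_zero_of_ker
    intro c hc
    ext j
    obtain ⟨p, hp⟩ := (hg.2.2 c).1 ((hH c).2 hc)
    have h1 := aeval_wordPoly c (ρ j)
    rw [hp, map_mul, hJ j j.2, zero_mul] at h1
    simp only [Matrix.mulVec, dotProduct, V, Matrix.of_apply, Pi.zero_apply]
    rw [h1]
    exact Finset.sum_congr rfl fun i _ => mul_comm _ _
  -- Over `K` the parity checks can be replaced by the Vandermonde rows of the roots; `B` is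
  -- invertible because `V` already has rank `M`.
  obtain ⟨B, hB⟩ := exists_eq_mul_of_ker_le _ V hker
  have hBrank : B.rank = M := by
    refine le_antisymm ((Matrix.rank_le_card_width B).trans (by simp)) ?_
    conv_lhs => rw [← hVrank, hB]
    exact Matrix.rank_mul_le_left _ _
  have hBdet : IsUnit B.det := by
    rw [← Matrix.isUnit_iff_isUnit_det, ← Matrix.mulVec_surjective_iff_isUnit]
    have h1 : LinearMap.range B.mulVecLin = ⊤ := by
      apply Submodule.eq_top_of_finrank_eq
      rw [Module.finrank_fin_fun]
      exact hBrank
    exact LinearMap.range_eq_top.1 h1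
  let φ : K →+* K := iterateFrobenius K 2 e
  have hφ : ∀ x, φ x = x ^ 2 ^ e := fun x => iterateFrobenius_def 2 e x
  have hBφ : IsUnit ((B.map φ).transpose).det := by
    rw [Matrix.det_transpose]
    have := hBdet.map φ
    rwa [RingHom.map_det] at this
  have hHH : (H * conjTranspose (2 ^ e) H).map (algebraMap F K) =
      H.map (algebraMap F K) * ((H.map (algebraMap F K)).map φ).transpose := by
    rw [Matrix.map_mul]
    congr 1
    ext i j
    simp [conjTranspose, hφ]
  have hW : V * (V.map φ).transpose =
      B * (H * conjTranspose (2 ^ e) H).map (algebraMap F K) * (B.map φ).transpose := by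
    rw [hHH]
    conv_lhs => rw [hB]
    rw [Matrix.map_mul, Matrix.transpose_mul]
    simp only [Matrix.mul_assoc]
  let R : Fin M → Fin M → Prop := fun i j => ρ i * ρ j ^ 2 ^ e = 1
  have hρn : ∀ j, ρ j ^ n = δ ^ n := by
    intro j
    simp only [ρ]
    rw [← pow_mul, add_mul, one_mul, pow_add, mul_assoc, mul_comm _ n, ← mul_assoc, pow_mul,
      hδ.pow_eq_one, one_pow, mul_one]
  have hn0 : (n : K) ≠ 0 := by
    have : NeZero (r * n) := ⟨(Nat.mul_pos hr0 hn).ne'⟩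
    have := (hδ.neZero' (R := K)).out
    rw [Nat.cast_mul] at this
    exact right_ne_zero_of_mul this
  -- Each entry is a geometric sum over the powers of the `n`-th root of unity `ρ i * ρ j ^ q`: it
  -- is `n` if this root is 1 and zero otherwise.
  have hentry : V * (V.map φ).transpose =
      (n : K) • Matrix.of fun i j => if R i j then (1 : K) else 0 := by
    ext i j
    simp only [Matrix.mul_apply, V, Matrix.of_apply, Matrix.transpose_apply, Matrix.map_apply,
      Matrix.smul_apply, smul_eq_mul, hφ]
    have h1 : ∀ k : Fin n, ρ i ^ (k : ℕ) * (ρ j ^ (k : ℕ)) ^ 2 ^ e =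
        (ρ i * ρ j ^ 2 ^ e) ^ (k : ℕ) := by
      intro k
      rw [mul_pow, pow_right_comm (ρ j)]
    simp only [h1]
    by_cases hR : R i j
    · have hR' : ρ i * ρ j ^ 2 ^ e = 1 := hR
      rw [if_pos hR]
      simp [hR']
    · rw [if_neg hR, mul_zero, Fin.sum_univ_eq_sum_range (fun k => (ρ i * ρ j ^ 2 ^ e) ^ k)]
      have h2 := geom_sum_mul (ρ i * ρ j ^ 2 ^ e) n
      -- This is where `r = q + 1` matters: the power is `δ ^ (n (1 + q)) = δ ^ (r n)`.
      have h3 : (ρ i * ρ j ^ 2 ^ e) ^ n = 1 := by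
        rw [mul_pow, pow_right_comm (ρ j), hρn, hρn, ← pow_mul, ← pow_add, ← hδ.pow_eq_one, hr]
        congr 1
        ring
      rw [h3, sub_self] at h2
      exact (mul_eq_zero.1 h2).resolve_right (sub_ne_zero.2 hR)
  have hrank : (H * conjTranspose (2 ^ e) H).rank = (V * (V.map φ).transpose).rank := by
    rw [hW, Matrix.rank_mul_eq_left_of_isUnit_det _ _ hBφ,
      Matrix.rank_mul_eq_right_of_isUnit_det _ _ hBdet, rank_map_algebraMap]
  rw [hrank, hentry, Matrix.rank_smul_of_mem_nonZeroDivisors _ (mem_nonZeroDivisors_of_ne_zero hn0),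
    rank_of_partial_perm]
  · refine Nat.card_congr (Equiv.subtypeEquivRight fun i => exists_congr fun j => ?_)
    simp only [R, ρ]
    rw [← pow_mul, ← pow_add, hδ.pow_eq_one_iff_dvd, mul_comm (1 + r * (h + (j : ℕ)))]
  · intro i j j' h1 h2
    have h0 : ρ i ≠ 0 := pow_ne_zero _ (hδ.ne_zero (Nat.mul_pos hr0 hn).ne')
    have h3 : φ (ρ j) = φ (ρ j') := by
      rw [hφ, hφ]
      exact mul_left_cancel₀ h0 (h1.trans h2.symm)
    exact hρinj (φ.injective h3)
  · intro i i' j h1 h2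
    have h0 : ρ j ^ 2 ^ e ≠ 0 :=
      pow_ne_zero _ (pow_ne_zero _ (hδ.ne_zero (Nat.mul_pos hr0 hn).ne'))
    exact hρinj (mul_right_cancel₀ h0 (h1.trans h2.symm))

end Rank

end Constacyclic

namespace Constacyclic

/-! ### Arithmetic of the defining set -/

section Arithmetic

variable {q r n s b m : ℕ}

/-- The point `s + r t` modulo `r n`. -/
def pt (r n s : ℕ) (t : ℤ) : ZMod (r * n) := (((s : ℤ) + r * t : ℤ) : ZMod (r * n))

lemma pt_eq_iff (hr : 0 < r) (t t' : ℤ) : pt r n s t = pt r n s t' ↔ (n : ℤ) ∣ t' - t := by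
  rw [pt, pt, ZMod.intCast_eq_intCast_iff_dvd_sub]
  have : ((s : ℤ) + r * t' - (s + r * t)) = r * (t' - t) := by ring
  rw [this, Nat.cast_mul, mul_dvd_mul_iff_left (by exact_mod_cast hr.ne')]

lemma pt_injOn (hr : 0 < r) {t t' : ℤ} (h : pt r n s t = pt r n s t') (h1 : t' - t < n)
    (h2 : -(n : ℤ) < t' - t) : t = t' := by
  rw [pt_eq_iff hr] at h
  have := Int.eq_zero_of_abs_lt_dvd h (by rw [abs_lt]; exact ⟨h2, h1⟩)
  omega

/-- From `q² - 1 = r(q - 1)`, `q² + 1 = 5n` and `s(q - 1) = 1 + 25bn`, the two sides differ by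
`-rn(25b + 5t)`. -/
lemma pt_mul_sq (hq : q = 10 * b + 2) (hr : r = 10 * b + 3) (hn : n = 20 * b ^ 2 + 8 * b + 1)
    (hs : s = (5 * b + 1) * (10 * b + 1)) (t : ℤ) :
    pt r n s t * (q : ZMod (r * n)) ^ 2 = pt r n s (1 - t) := by
  have h1 : pt r n s t * (q : ZMod (r * n)) ^ 2 =
      ((((s : ℤ) + r * t) * q ^ 2 : ℤ) : ZMod (r * n)) := by
    rw [pt]
    push_cast
    ring
  rw [h1, pt, ZMod.intCast_eq_intCast_iff_dvd_sub]
  refine ⟨-(25 * b + 5 * t), ?_⟩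
  subst hq hr hn hs
  push_cast
  ring

lemma cyclotomicCoset_pt (hq : q = 10 * b + 2) (hr : r = 10 * b + 3)
    (hn : n = 20 * b ^ 2 + 8 * b + 1) (hs : s = (5 * b + 1) * (10 * b + 1)) (t : ℤ) :
    cyclotomicCoset q (r * n) (pt r n s t) = {pt r n s t, pt r n s (1 - t)} := by
  have hsq := pt_mul_sq hq hr hn hs
  have key : ∀ j : ℕ, pt r n s t * (q : ZMod (r * n)) ^ (2 * j) = pt r n s t ∨
      pt r n s t * (q : ZMod (r * n)) ^ (2 * j) = pt r n s (1 - t) := by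
    intro j
    induction j with
    | zero => left; simp
    | succ j ih =>
      rw [mul_add, mul_one, pow_add, ← mul_assoc]
      rcases ih with h | h
      · right
        rw [h, hsq]
      · left
        rw [h, hsq, sub_sub_cancel]
  ext x
  constructor
  · rintro ⟨j, rfl⟩
    exact key j
  · rintro (rfl | rfl)
    · exact ⟨0, by simp⟩
    · exact ⟨1, by rw [mul_one, hsq]⟩

lemma iUnion_cyclotomicCoset (hq : q = 10 * b + 2) (hr : r = 10 * b + 3)
    (hn : n = 20 * b ^ 2 + 8 * b + 1) (hs : s = (5 * b + 1) * (10 * b + 1)) :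
    (⋃ j ∈ Finset.Icc 0 m, cyclotomicCoset q (r * n)
      ((s : ZMod (r * n)) - (r : ZMod (r * n)) * (j : ZMod (r * n)))) =
      pt r n s '' Set.Icc (-m : ℤ) (m + 1) := by
  have hpt : ∀ j : ℕ, (s : ZMod (r * n)) - (r : ZMod (r * n)) * (j : ZMod (r * n)) =
      pt r n s (-j) := by
    intro j
    rw [pt]
    push_cast
    ring
  ext x
  simp only [Set.mem_iUnion, hpt, cyclotomicCoset_pt hq hr hn hs, Set.mem_image, Set.mem_Icc,
    Finset.mem_Icc, Set.mem_insert_iff, Set.mem_singleton_iff, exists_prop]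
  constructor
  · rintro ⟨j, hj, rfl | rfl⟩
    · exact ⟨-j, by omega, rfl⟩
    · exact ⟨1 - -j, by omega, rfl⟩
  · rintro ⟨t, ht, rfl⟩
    by_cases h : t ≤ 0
    · refine ⟨(-t).toNat, by omega, Or.inl ?_⟩
      congr 1
      omega
    · refine ⟨(t - 1).toNat, by omega, Or.inr ?_⟩
      congr 1
      omega

lemma eq_one_or_eq_neg_one_of_odd {x : ℤ} (h : x ^ 2 < 9) (hx : x % 2 = 1) :
    x = 1 ∨ x = -1 := by
  obtain ⟨h2, h3⟩ := abs_lt_of_sq_lt_sq' (show x ^ 2 < 3 ^ 2 by omega) (by norm_num)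
  omega

/-- The point is `10(20B² + 8B + 1) > 2(10B + 1)²`. -/
lemma sq_add_sq_lt_of_mul_le {B w : ℤ} (hB : 0 ≤ B)
    (h : (20 * B ^ 2 + 8 * B + 1) * w ≤ 2 * (10 * B + 1) ^ 2) : w < 10 := by
  by_contra! hw
  have : (20 * B ^ 2 + 8 * B + 1) * 10 ≤ (20 * B ^ 2 + 8 * B + 1) * w :=
    mul_le_mul_of_nonneg_left hw (by positivity)
  nlinarith

/-- The two-dimensional lattice that describes the intersection of the defining set with its
conjugate. -/
lemma dvd_iff_of_mem_Icc (hq : q = 10 * b + 2)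
    (hn : n = 20 * b ^ 2 + 8 * b + 1) (hs : s = (5 * b + 1) * (10 * b + 1)) (hm : m ≤ 5 * b)
    {t t' : ℤ} (ht : -m ≤ t) (ht1 : t ≤ m + 1) (ht' : -m ≤ t') (ht1' : t' ≤ m + 1) :
    (n : ℤ) ∣ s + q * t + t' ↔ (t = 3 * b + 1 ∧ t' = b + 1) ∨ (t = -b ∧ t' = 3 * b + 1) ∨
      (t = b + 1 ∧ t' = -(3 * b)) ∨ (t = -(3 * b) ∧ t' = -b) := by
  subst hq hn hs
  push_cast
  set B := (b : ℤ) with hB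
  have hB0 : 0 ≤ B := by omega
  constructor
  · rintro ⟨k, hk⟩
    -- Centring turns `t ↦ 1 - t` into `u ↦ -u`. Since `2s + q + 1 = 5n`, the condition becomes `q u
    -- + u' = n l` with `l` odd.
    set u : ℤ := 2 * t - 1 with hu
    set u' : ℤ := 2 * t' - 1 with hu'
    set l : ℤ := 2 * k - 5 with hl
    have hlin : (10 * B + 2) * u + u' = (20 * B ^ 2 + 8 * B + 1) * l := by
      rw [hu, hu', hl]
      linear_combination 2 * hk
    -- `x, y` are the coordinates of `(u, u')` in the orthogonal lattice basis `(2B, 4B+1)`, `(4B+1,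
    -- -2B)`, both of squared length `n`.
    set x : ℤ := (4 * B + 1) * l - 2 * u with hx
    set y : ℤ := u - 2 * B * l with hy
    have e1 : u' = (4 * B + 1) * x - 2 * B * y := by
      rw [hx, hy]
      linear_combination hlin
    have e2 : u = 2 * B * x + (4 * B + 1) * y := by
      rw [hx, hy]
      ring
    have hub : u ^ 2 ≤ (10 * B + 1) ^ 2 := by
      apply sq_le_sq'
      · omega
      · omega
    have hub' : u' ^ 2 ≤ (10 * B + 1) ^ 2 := by
      apply sq_le_sq'
      · omega
      · omega
    have hsum : (20 * B ^ 2 + 8 * B + 1) * (x ^ 2 + y ^ 2) = u ^ 2 + u' ^ 2 := by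
      rw [e1, e2]
      ring
    have hlt : x ^ 2 + y ^ 2 < 10 := by
      apply sq_add_sq_lt_of_mul_le hB0
      rw [hsum, two_mul]
      exact add_le_add hub hub'
    -- `x ≡ l` and `y ≡ u` modulo 2, so both are odd. Each square is positive, hence the other is
    -- below 9.
    have hlodd : l % 2 = 1 := by omega
    have hyodd : y % 2 = 1 := by
      have : u = y + 2 * (B * l) := by rw [hy]; ring
      omega
    have hxodd : x % 2 = 1 := by
      have : x = l + 2 * (2 * (B * l) - u) := by rw [hx]; ring
      omega
    have hy2 : 0 < y ^ 2 := by
      have : y ≠ 0 := by omega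
      positivity
    have hx2 : 0 < x ^ 2 := by
      have : x ≠ 0 := by omega
      positivity
    have hx1 := eq_one_or_eq_neg_one_of_odd (by omega) hxodd
    have hy1 := eq_one_or_eq_neg_one_of_odd (by omega) hyodd
    rcases hx1 with h1 | h1 <;> rcases hy1 with h2 | h2 <;> rw [h1, h2] at e1 e2 <;> omega
  · rintro (⟨rfl, rfl⟩ | ⟨rfl, rfl⟩ | ⟨rfl, rfl⟩ | ⟨rfl, rfl⟩)
    -- The quotients are `(5 + x + 2y) / 2` for the four choices of signs.
    · exact ⟨4, by ring⟩
    · exact ⟨2, by ring⟩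
    · exact ⟨3, by ring⟩
    · exact ⟨1, by ring⟩

/-- Because `r = q + 1`, `-q s = s - r s`; so `-q` acts on the parameter `t` by an affine map. -/
lemma neg_mul_pt (hq : q = 10 * b + 2) (hr : r = 10 * b + 3) (t : ℤ) :
    -(q : ZMod (r * n)) * pt r n s t = pt r n s (-(s + q * t)) := by
  have h : (r : ℤ) = q + 1 := by omega
  have h1 : -(q : ZMod (r * n)) * pt r n s t =
      ((-(q : ℤ) * (s + r * t) : ℤ) : ZMod (r * n)) := by
    rw [pt]
    push_cast
    ring
  rw [h1, pt]
  congr 1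
  rw [h]
  ring

lemma inter_negMul (hq : q = 10 * b + 2) (hr : r = 10 * b + 3)
    (hn : n = 20 * b ^ 2 + 8 * b + 1) (hs : s = (5 * b + 1) * (10 * b + 1)) (hm : m ≤ 5 * b)
    (hm' : 3 * b ≤ m) :
    (pt r n s '' Set.Icc (-m : ℤ) (m + 1)) ∩ negMul q (pt r n s '' Set.Icc (-m : ℤ) (m + 1)) =
      {pt r n s (-(3 * b)), pt r n s (3 * b + 1)} ∪ {pt r n s (-b), pt r n s (b + 1)} := by
  have hr0 : 0 < r := by omega
  ext x
  constructor
  · rintro ⟨⟨t', ht', rfl⟩, _, ⟨t, ht, rfl⟩, h⟩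
    dsimp only at h
    rw [neg_mul_pt hq hr, pt_eq_iff hr0] at h
    have e : t' - -((s : ℤ) + q * t) = s + q * t + t' := by ring
    rw [e, dvd_iff_of_mem_Icc hq hn hs hm ht.1 ht.2 ht'.1 ht'.2] at h
    rcases h with ⟨-, rfl⟩ | ⟨-, rfl⟩ | ⟨-, rfl⟩ | ⟨-, rfl⟩ <;> simp
  · have key : ∀ t t' : ℤ, -m ≤ t → t ≤ m + 1 → -m ≤ t' → t' ≤ m + 1 →
        ((t = 3 * b + 1 ∧ t' = b + 1) ∨ (t = -b ∧ t' = 3 * b + 1) ∨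
        (t = b + 1 ∧ t' = -(3 * b)) ∨ (t = -(3 * b) ∧ t' = -b)) → pt r n s t' ∈
        (pt r n s '' Set.Icc (-m : ℤ) (m + 1)) ∩
          negMul q (pt r n s '' Set.Icc (-m : ℤ) (m + 1)) := by
      intro t t' h1 h2 h3 h4 h
      refine ⟨⟨t', ⟨h3, h4⟩, rfl⟩, _, ⟨t, ⟨h1, h2⟩, rfl⟩, ?_⟩
      dsimp only
      rw [neg_mul_pt hq hr, pt_eq_iff hr0]
      have e : t' - -((s : ℤ) + q * t) = s + q * t + t' := by ring
      rw [e]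
      exact (dvd_iff_of_mem_Icc hq hn hs hm h1 h2 h3 h4).2 h
    rintro ((rfl | rfl) | (rfl | rfl))
    · exact key (b + 1) _ (by omega) (by omega) (by omega) (by omega) (by omega)
    · exact key (-b) _ (by omega) (by omega) (by omega) (by omega) (by omega)
    · exact key (-(3 * b)) _ (by omega) (by omega) (by omega) (by omega) (by omega)
    · exact key (3 * b + 1) _ (by omega) (by omega) (by omega) (by omega) (by omega)

/-- The number of conjugate inverse pairs of roots. -/
lemma card_conjugate_pairs (hb : 0 < b) (hq : q = 10 * b + 2) (hr : r = 10 * b + 3)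
    (hn : n = 20 * b ^ 2 + 8 * b + 1) (hm : m ≤ 5 * b)
    (hm' : 3 * b ≤ m) :
    Nat.card {i : Fin (2 * m + 2) // ∃ j : Fin (2 * m + 2),
      r * n ∣ (1 + r * (5 * b - m + i)) + q * (1 + r * (5 * b - m + j))} = 4 := by
  have hs : (5 * b + 1) * (10 * b + 1) = 1 + r * (5 * b) := by rw [hr]; ring
  have key : ∀ i j : Fin (2 * m + 2),
      r * n ∣ (1 + r * (5 * b - m + i)) + q * (1 + r * (5 * b - m + j)) ↔
      (n : ℤ) ∣ ((5 * b + 1) * (10 * b + 1) : ℕ) + q * ((j : ℤ) - m) + ((i : ℤ) - m) := by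
    intro i j
    rw [← Int.natCast_dvd_natCast]
    have e : (((1 + r * (5 * b - m + i)) + q * (1 + r * (5 * b - m + j)) : ℕ) : ℤ) =
        r * (((5 * b + 1) * (10 * b + 1) : ℕ) + q * ((j : ℤ) - m) + ((i : ℤ) - m)) := by
      push_cast [Nat.cast_sub hm, hr, hq]
      ring
    rw [e, Nat.cast_mul, mul_dvd_mul_iff_left (by rw [hr]; positivity)]
  -- The indices `m + t'` for the four solutions `t'` of `dvd_iff_of_mem_Icc`.
  let S : Finset (Fin (2 * m + 2)) := {⟨m + b + 1, by omega⟩, ⟨m + 3 * b + 1, by omega⟩,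
    ⟨m - 3 * b, by omega⟩, ⟨m - b, by omega⟩}
  have hS : S.card = 4 := by
    rw [Finset.card_insert_of_notMem, Finset.card_insert_of_notMem,
      Finset.card_insert_of_notMem, Finset.card_singleton]
    all_goals
      simp only [Finset.mem_insert, Finset.mem_singleton, Fin.mk.injEq]
      omega
  rw [← hS]
  refine Nat.subtype_card S fun i => ?_
  have hi := i.isLt
  have key2 : ∀ j : Fin (2 * m + 2),
      r * n ∣ (1 + r * (5 * b - m + i)) + q * (1 + r * (5 * b - m + j)) ↔ _ := fun j =>
    (key i j).trans (dvd_iff_of_mem_Icc hq hn rfl hm (by omega)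
      (by have := j.isLt; omega) (by omega) (by omega))
  simp only [key2, S, Finset.mem_insert, Finset.mem_singleton, Fin.ext_iff]
  constructor
  · rintro (h | h | h | h)
    · exact ⟨⟨m + 3 * b + 1, by omega⟩, by dsimp only; omega⟩
    · exact ⟨⟨m - b, by omega⟩, by dsimp only; omega⟩
    · exact ⟨⟨m + b + 1, by omega⟩, by dsimp only; omega⟩
    · exact ⟨⟨m - 3 * b, by omega⟩, by dsimp only; omega⟩
  · rintro ⟨j, hj⟩
    omega

end Arithmetic

end Constacyclic

namespace Constacyclic

open Module Polynomial

/-! ### Existence of codes with prescribed roots -/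

section Existence

variable {F K : Type*} [Field F] [Field K] [Algebra F K] {r n : ℕ} {δ : K} {α : F}

/-- The image of `F` already exhausts the at most `|F|` roots of `X ^ |F| - X`. -/
lemma mem_range_algebraMap_of_pow_card_eq [Fintype F] {x : K} (hx : x ^ Fintype.card F = x) :
    x ∈ Set.range (algebraMap F K) := by
  classical
  by_contra hne
  have h1 : 1 < Fintype.card F := Fintype.one_lt_card
  have h0 : (X ^ Fintype.card F - X : K[X]) ≠ 0 := FiniteField.X_pow_card_sub_X_ne_zero K h1
  have hsub : insert x (Finset.univ.image (algebraMap F K)) ⊆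
      (X ^ Fintype.card F - X : K[X]).roots.toFinset := by
    intro y hy
    rw [Multiset.mem_toFinset, mem_roots h0]
    rcases Finset.mem_insert.1 hy with rfl | hy
    · simp [hx]
    · obtain ⟨a, -, rfl⟩ := Finset.mem_image.1 hy
      simp [← map_pow, FiniteField.pow_card]
  have h2 := (Finset.card_le_card hsub).trans ((Multiset.toFinset_card_le _).trans (card_roots' _))
  rw [Finset.card_insert_of_notMem, Finset.card_image_of_injective _ (algebraMap F K).injective,
    FiniteField.X_pow_card_sub_X_natDegree_eq K h1, Finset.card_univ] at h2
  · omega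
  · intro h
    obtain ⟨a, -, rfl⟩ := Finset.mem_image.1 h
    exact hne ⟨a, rfl⟩

/-- A set of roots that is closed under `x ↦ x ^ |F|` is the set of roots of a polynomial
over `F`. -/
lemma exists_monic_dvd [Fintype F] {p e : ℕ} [Fact p.Prime] [CharP K p]
    (hF : Fintype.card F = p ^ e)
    (hδ : IsPrimitiveRoot δ (r * n)) (hr : 0 < r) (hn : 0 < n)
    (hδα : δ ^ n = algebraMap F K α) {J : Finset ℕ} (hJn : ∀ j ∈ J, j < n)
    (hJ : ∀ j ∈ J, ∃ j' ∈ J, (δ ^ (1 + r * j)) ^ Fintype.card F = δ ^ (1 + r * j')) :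
    ∃ g : F[X], g.Monic ∧ g ∣ X ^ n - Polynomial.C α ∧
      ∀ j < n, aeval (δ ^ (1 + r * j)) g = 0 ↔ j ∈ J := by
  classical
  let T : Finset K := J.image fun j => δ ^ (1 + r * j)
  let G : K[X] := ∏ x ∈ T, (X - Polynomial.C x)
  let φ : K →+* K := iterateFrobenius K p e
  have hφ : ∀ x, φ x = x ^ Fintype.card F := fun x => by
    rw [hF]
    exact iterateFrobenius_def p e x
  -- Frobenius is injective, so it permutes the finite set `T` and fixes the coefficients of `G`.
  have hT : T.image φ = T := by
    refine Finset.eq_of_subset_of_card_le ?_ ?_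
    · intro x hx
      obtain ⟨y, hy, rfl⟩ := Finset.mem_image.1 hx
      obtain ⟨j, hj, rfl⟩ := Finset.mem_image.1 hy
      obtain ⟨j', hj', h⟩ := hJ j hj
      rw [hφ, h]
      exact Finset.mem_image_of_mem _ hj'
    · rw [Finset.card_image_of_injective _ φ.injective]
  have hGφ : G.map φ = G := by
    simp only [G, Polynomial.map_prod, Polynomial.map_sub, map_X, map_C]
    conv_rhs => rw [← hT, Finset.prod_image fun x _ y _ h => φ.injective h]
  have hlift : G ∈ lifts (algebraMap F K) := by
    rw [lifts_iff_coeff_lifts]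
    intro i
    apply mem_range_algebraMap_of_pow_card_eq
    rw [← hφ, ← coeff_map, hGφ]
  obtain ⟨g, hg⟩ := (lifts_iff_set_range _).1 hlift
  have hprod : G = ∏ j ∈ J, (X - Polynomial.C (δ ^ (1 + r * j))) := by
    refine Finset.prod_image fun i hi j hj h => ?_
    exact pow_one_add_mul_injOn hδ hr hn (hJn i hi) (hJn j hj) h
  refine ⟨g, ?_, ?_, fun j hj => ?_⟩
  · apply monic_of_injective (algebraMap F K).injective
    rw [hg]
    exact monic_prod_of_monic _ _ fun x _ => monic_X_sub_C x
  · rw [← Polynomial.map_dvd_map' (algebraMap F K), hg, Polynomial.map_sub, Polynomial.map_pow,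
      map_X, map_C, ← hδα, X_pow_sub_C_eq_prod_pow hδ hr hn, hprod]
    exact Finset.prod_dvd_prod_of_subset _ _ _ fun j hj => Finset.mem_range.2 (hJn j hj)
  · rw [← eval_map_algebraMap, hg, hprod, eval_prod, Finset.prod_eq_zero_iff]
    constructor
    · rintro ⟨i, hi, h⟩
      rw [eval_sub, eval_X, eval_C, sub_eq_zero] at h
      rwa [pow_one_add_mul_injOn hδ hr hn hj (hJn i hi) h]
    · intro h
      exact ⟨j, h, by simp⟩

/-- The shift is multiplication by `X` reduced modulo `X ^ n - α`, so it preserves divisibility by a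
divisor `g`. -/
lemma wordPoly_shift (hn : 0 < n) (c : Fin n → F) :
    wordPoly (shift α c) = X * wordPoly c -
      Polynomial.C (c ⟨n - 1, by omega⟩) * (X ^ n - Polynomial.C α) := by
  obtain ⟨k, rfl⟩ : ∃ k, n = k + 1 := ⟨n - 1, by omega⟩
  rw [wordPoly, wordPoly, Fin.sum_univ_succ, Fin.sum_univ_castSucc, mul_add, Finset.mul_sum]
  have h1 : shift α c 0 = α * c (Fin.last k) := by
    simp [shift, Fin.last]
  have h2 : ∀ i : Fin k, shift α c i.succ = c i.castSucc := by
    intro i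
    simp [shift, Fin.castSucc, Fin.castAdd, Fin.castLE]
  have h3 : (⟨k + 1 - 1, by omega⟩ : Fin (k + 1)) = Fin.last k := rfl
  simp only [h1, h2, h3, Fin.val_succ, Fin.val_castSucc, Fin.val_last, Fin.val_zero, pow_zero,
    mul_one, C_mul]
  have h4 : ∑ i : Fin k, Polynomial.C (c i.castSucc) * X ^ ((i : ℕ) + 1) =
      ∑ i : Fin k, X * (Polynomial.C (c i.castSucc) * X ^ (i : ℕ)) :=
    Finset.sum_congr rfl fun i _ => by ring
  rw [h4]
  ring

lemma exists_isGenerator (hn : 0 < n) {g : F[X]} (hg : g.Monic)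
    (hdvd : g ∣ X ^ n - Polynomial.C α) :
    ∃ C : Submodule F (Fin n → F), IsConstacyclic α C ∧ IsGenerator α g C := by
  refine ⟨((Ideal.span {g}).restrictScalars F).comap (wordLin F n), fun c hc => ?_, hg, hdvd,
    fun c => Ideal.mem_span_singleton⟩
  have hc' : g ∣ wordPoly c := Ideal.mem_span_singleton.1 hc
  refine Ideal.mem_span_singleton.2 ?_
  change g ∣ wordPoly (shift α c)
  rw [wordPoly_shift hn]
  exact dvd_sub (hc'.mul_left _) (hdvd.mul_left _)

/-- `δ ^ a` depends only on `a` modulo `r n`, and the exponents `1 + r j` with `j < n` give distinct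
powers. -/
lemma definingSet_eq (hδ : IsPrimitiveRoot δ (r * n)) (hr : 0 < r) (hn : 0 < n) {g : F[X]}
    {J : Finset ℕ} (hJn : ∀ j ∈ J, j < n) :
    definingSet r n δ g = (fun j : ℕ => ((1 + r * j : ℕ) : ZMod (r * n))) '' J ↔
      ∀ j < n, aeval (δ ^ (1 + r * j)) g = 0 ↔ j ∈ J := by
  have hval : ∀ a : ℕ, δ ^ ((a : ZMod (r * n)).val) = δ ^ a := by
    intro a
    rw [ZMod.val_natCast, hδ.eq_orderOf, pow_mod_orderOf]
  have hinj : ∀ i < n, ∀ j < n, ((1 + r * i : ℕ) : ZMod (r * n)) = ((1 + r * j : ℕ) : ZMod (r * n)) →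
      i = j := by
    intro i hi j hj h
    apply pow_one_add_mul_injOn hδ hr hn hi hj
    rw [← hval, h, hval]
  have hmem : ∀ j < n, ((1 + r * j : ℕ) : ZMod (r * n)) ∈ definingSet r n δ g ↔
      aeval (δ ^ (1 + r * j)) g = 0 := by
    intro j hj
    constructor
    · rintro ⟨-, h⟩
      rwa [hval] at h
    · intro h
      exact ⟨⟨j, hj, by push_cast; rfl⟩, by rwa [hval]⟩
  constructor
  · intro h j hj
    rw [← hmem j hj, h]
    constructor
    · rintro ⟨i, hi, hij⟩
      rwa [← hinj i (hJn i hi) j hj hij]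
    · intro hjJ
      exact ⟨j, hjJ, rfl⟩
  · intro h
    ext x
    constructor
    · intro hx
      obtain ⟨⟨j, hj, hxj⟩, -⟩ := id hx
      have hxj' : x = ((1 + r * j : ℕ) : ZMod (r * n)) := by rw [hxj]; push_cast; rfl
      rw [hxj', hmem j hj, h j hj] at hx
      exact ⟨j, hx, hxj'.symm⟩
    · rintro ⟨j, hj, rfl⟩
      exact (hmem j (hJn j hj)).2 ((h j (hJn j hj)).2 hj)

end Existence

end Constacyclic

namespace Constacyclic

open Module Polynomial

/-! ### The codes with defining set `Z` and their parameters -/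

section Family

variable {q r n s b m : ℕ}

/-- Since `s = 1 + 5br`, the centred parameter `t` corresponds to the index `j = 5b + t`. -/
lemma pt_eq_natCast (hr : r = 10 * b + 3) (hs : s = (5 * b + 1) * (10 * b + 1)) {t : ℤ} {j : ℕ}
    (hj : (j : ℤ) = 5 * b + t) : ((1 + r * j : ℕ) : ZMod (r * n)) = pt r n s t := by
  have h : ((1 + r * j : ℕ) : ℤ) = s + r * t := by
    push_cast [hj, hr, hs]
    ring
  rw [pt, ← h, Int.cast_natCast]

lemma image_pt_Icc (hr : r = 10 * b + 3) (hs : s = (5 * b + 1) * (10 * b + 1)) (hm : m ≤ 5 * b) :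
    pt r n s '' Set.Icc (-m : ℤ) (m + 1) = (fun j : ℕ => ((1 + r * j : ℕ) : ZMod (r * n))) ''
      (Finset.Ico (5 * b - m) (5 * b - m + (2 * m + 2)) : Finset ℕ) := by
  ext x
  simp only [Set.mem_image, Set.mem_Icc, Finset.coe_Ico, Set.mem_Ico]
  constructor
  · rintro ⟨t, ht, rfl⟩
    exact ⟨(5 * b + t).toNat, by omega, pt_eq_natCast hr hs (by omega)⟩
  · rintro ⟨j, hj, rfl⟩
    exact ⟨j - 5 * b, by omega, (pt_eq_natCast hr hs (by omega)).symm⟩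

variable {F K : Type*} [Field F] [Fintype F] [Field K] [Algebra F K] {α : F} {δ : K} {e : ℕ}

lemma exists_isGenerator_definingSet [CharP F 2] (hqe : q = 2 ^ e) (hq : q = 10 * b + 2)
    (hr : r = 10 * b + 3) (hn : n = 20 * b ^ 2 + 8 * b + 1) (hs : s = (5 * b + 1) * (10 * b + 1))
    (hm : m ≤ 5 * b) (hmn : 5 * b + m + 2 ≤ n) (hF : Fintype.card F = q ^ 2)
    (hδ : IsPrimitiveRoot δ (r * n)) (hδα : δ ^ n = algebraMap F K α) :
    ∃ (C : Submodule F (Fin n → F)) (g : F[X]), IsConstacyclic α C ∧ IsGenerator α g C ∧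
      definingSet r n δ g = pt r n s '' Set.Icc (-m : ℤ) (m + 1) := by
  have hr0 : 0 < r := by omega
  have hn0 : 0 < n := by omega
  have : CharP K 2 := charP_of_injective_algebraMap (algebraMap F K).injective 2
  have hJn : ∀ j ∈ Finset.Ico (5 * b - m) (5 * b - m + (2 * m + 2)), j < n := by
    intro j hj
    rw [Finset.mem_Ico] at hj
    omega
  have hclosed : ∀ j ∈ Finset.Ico (5 * b - m) (5 * b - m + (2 * m + 2)),
      ∃ j' ∈ Finset.Ico (5 * b - m) (5 * b - m + (2 * m + 2)),
        (δ ^ (1 + r * j)) ^ Fintype.card F = δ ^ (1 + r * j') := by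
    intro j hj
    rw [Finset.mem_Ico] at hj
    -- The reflection `t ↦ 1 - t` in terms of `j = 5b + t`.
    refine ⟨10 * b + 1 - j, by rw [Finset.mem_Ico]; omega, ?_⟩
    have h := pt_mul_sq hq hr hn hs (j - 5 * b : ℤ)
    rw [← pt_eq_natCast (j := j) hr hs (by omega),
      ← pt_eq_natCast (j := 10 * b + 1 - j) hr hs (by omega), ← Nat.cast_pow, ← Nat.cast_mul,
      ZMod.natCast_eq_natCast_iff] at h
    rw [← pow_mul, hF]
    rw [hδ.eq_orderOf] at h
    rw [← pow_mod_orderOf, h, pow_mod_orderOf]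
  obtain ⟨g, hg, hdvd, hroots⟩ := exists_monic_dvd (p := 2) (e := e * 2)
    (by rw [hF, hqe, pow_mul]) hδ hr0 hn0 hδα hJn hclosed
  obtain ⟨C, hC, hgC⟩ := exists_isGenerator hn0 hg hdvd
  refine ⟨C, g, hC, hgC, ?_⟩
  rw [image_pt_Icc hr hs hm]
  exact (definingSet_eq hδ hr0 hn0 hJn).2 hroots

/-- There are `M = 2m + 2` consecutive roots: `dim C = n - M`, `d = M + 1`, the dual has dimension
`M` and the hull `M - 4`. Hence `k = n - 2M + 4 = n - 4m`. -/
lemma parameters_of_definingSet [DecidableEq F] [CharP F 2] (he : 0 < e) (hqe : q = 2 ^ e)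
    (hb : 0 < b) (hq : q = 10 * b + 2) (hr : r = 10 * b + 3) (hn : n = 20 * b ^ 2 + 8 * b + 1)
    (hs : s = (5 * b + 1) * (10 * b + 1)) (hm : m ≤ 5 * b) (hm' : 3 * b ≤ m)
    (hmn : 4 * m + 5 ≤ n) (hF : Fintype.card F = q ^ 2)
    (hδ : IsPrimitiveRoot δ (r * n)) (hδα : δ ^ n = algebraMap F K α)
    {C : Submodule F (Fin n → F)} {g : F[X]} (hg : IsGenerator α g C)
    (hZ : definingSet r n δ g = pt r n s '' Set.Icc (-m : ℤ) (m + 1)) (hbn : 10 * b + 2 ≤ n) :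
    finrank F C + (2 * m + 2) = n ∧ HasMinDistance C (2 * m + 3) ∧
      (∀ H : Matrix (Fin (n - finrank F C)) (Fin n) F, IsParityCheck H C →
        (H * conjTranspose q H).rank = 4) ∧
      EAQ.ExistsCode q n (n - 4 * m) (2 * m + 3) 4 := by
  have hr0 : 0 < r := by omega
  have hn0 : 0 < n := by omega
  have hJn : ∀ j ∈ Finset.Ico (5 * b - m) (5 * b - m + (2 * m + 2)), j < n := by
    intro j hj
    rw [Finset.mem_Ico] at hj
    omega
  rw [image_pt_Icc hr hs hm] at hZ
  have hroots := (definingSet_eq hδ hr0 hn0 hJn).1 hZ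
  have hdeg : g.natDegree = 2 * m + 2 := by
    rw [natDegree_eq_card_of_roots hδ hr0 hn0 hδα hg.1 hg.2.1 hJn hroots, Nat.card_Ico]
    omega
  have hJ : ∀ i < 2 * m + 2, aeval (δ ^ (1 + r * (5 * b - m + i))) g = 0 := by
    intro i hi
    exact (hroots _ (by omega)).2 (by rw [Finset.mem_Ico]; omega)
  have hrank : finrank F C + (2 * m + 2) = n := by
    rw [← hdeg]
    exact finrank_of_isGenerator hg (by omega)
  obtain ⟨hdist, hgC, hg0, hgw⟩ := hasMinDistance_of_isGenerator hδ hr0 hg (h := 5 * b - m)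
    (by omega) (by rw [hdeg]; exact hJ)
  rw [hdeg] at hdist hgw
  subst hqe
  have hHrank : ∀ H : Matrix (Fin (2 * m + 2)) (Fin n) F, IsParityCheck H C →
      (H * conjTranspose (2 ^ e) H).rank = 4 := by
    intro H hH
    rw [rank_mul_conjTranspose hδ (by omega) hn0 hg (by omega) hJ hH,
      card_conjugate_pairs hb hq hr hn hm hm']
  have hlow : ∀ c ∈ C, c ≠ 0 → 2 * m + 2 < hammingNorm c := fun c hc hc0 =>
    hdist.2 ⟨c, hc, hc0, rfl⟩
  refine ⟨hrank, hdist, ?_, ?_⟩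
  · rwa [show n - finrank F C = 2 * m + 2 by omega]
  · obtain ⟨H, hH⟩ := exists_parityCheck C hrank
    have hdual := finrank_hermitianDual hF (by omega) hlow hH
    have hhull := finrank_inf_hermitianDual hF (by omega) hlow hH
    rw [hHrank H hH] at hhull
    refine EAQ.existsCode_of_hermitianDual he hF C (ρ := 2 * m + 2 - 4) (by omega) (by omega)
      (by omega) hlow ⟨_, hgC, fun hmem => hg0 ?_, hgw⟩
    -- The word of `g` vanishes at the `M` positions `2m + 3, …, 4m + 4`, which exist because `4m +
    -- 5 ≤ n`; in the dual this would make it zero.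
    refine eq_zero_of_mem_hermitianDual hF hlow hH
      (J := fun k => ⟨2 * m + 3 + k, by have := k.isLt; omega⟩) ?_ hmem fun k => ?_
    · intro k l hkl
      simp only [Fin.mk.injEq] at hkl
      ext
      omega
    · exact coeff_eq_zero_of_natDegree_lt (by rw [hdeg]; dsimp only; omega)

end Family

end Constacyclic

/-! ### The main theorem -/

theorem mainTheorem5
    (e q r n s lam : ℕ) (hq : q = 2 ^ e) (hq10 : q ≡ 2 [MOD 10]) (hq2 : q ≠ 2)
    (hr : r = q + 1) (hn : n = (q ^ 2 + 1) / 5) (hs : s = (q ^ 2 - q) / 2)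
    (hlam : 1 ≤ lam) (hlam' : (lam : ℚ) ≤ ((q : ℚ) + 3) / 5)
    {F : Type*} [Field F] [Fintype F] [DecidableEq F] (hF : Fintype.card F = q ^ 2)
    {K : Type*} [Field K] [Algebra F K]
    (α : F) (hα : IsPrimitiveRoot α r)
    (δ : K) (hδ : IsPrimitiveRoot δ (r * n)) (hδα : δ ^ n = algebraMap F K α)
    (Z : Set (ZMod (r * n)))
    (hZ : Z = ⋃ j ∈ Finset.Icc 0 (3 * (q - 2) / 10 - 1 + lam),
      Constacyclic.cyclotomicCoset q (r * n)
        ((s : ZMod (r * n)) - (r : ZMod (r * n)) * (j : ZMod (r * n)))) :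
    -- there is a constacyclic code with defining set `Z`
    (∃ (C : Submodule F (Fin n → F)) (g : Polynomial F), Constacyclic.IsConstacyclic α C ∧
      Constacyclic.IsGenerator α g C ∧ Constacyclic.definingSet r n δ g = Z) ∧
    -- `Z ∩ (-qZ)` is the disjoint union of two cosets with two elements each
    (∃ Z₁ Z₂ : Set (ZMod (r * n)),
      Z₁ = Constacyclic.cyclotomicCoset q (r * n)
        ((s : ZMod (r * n)) - (r : ZMod (r * n)) * ((3 * (q - 2) / 10 : ℕ) : ZMod (r * n))) ∧
      Z₂ = Constacyclic.cyclotomicCoset q (r * n)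
        ((s : ZMod (r * n)) - (r : ZMod (r * n)) * (((q - 2) / 10 : ℕ) : ZMod (r * n))) ∧
      Z ∩ Constacyclic.negMul q Z = Z₁ ∪ Z₂ ∧ Disjoint Z₁ Z₂ ∧ Z₁.ncard = 2 ∧ Z₂.ncard = 2) ∧
    -- every such code yields an entanglement-assisted quantum MDS code
    (∀ (C : Submodule F (Fin n → F)) (g : Polynomial F), Constacyclic.IsConstacyclic α C →
      Constacyclic.IsGenerator α g C → Constacyclic.definingSet r n δ g = Z →
      ∃ k d : ℕ,
        (k : ℚ) = (n : ℚ) - 6 / 5 * ((q : ℚ) - 2) - 4 * (lam : ℚ) + 4 ∧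
        (d : ℚ) = 3 / 5 * ((q : ℚ) - 2) + 2 * (lam : ℚ) + 1 ∧
        Constacyclic.HasMinDistance C d ∧
        (k : ℤ) = 2 * (Module.finrank F C : ℤ) - (n : ℤ) + 4 ∧
        (∀ H : Matrix (Fin (n - Module.finrank F C)) (Fin n) F, Constacyclic.IsParityCheck H C →
          (H * Constacyclic.conjTranspose q H).rank = 4) ∧
        EAQ.ExistsMDSCode q n k d 4) := by
  obtain ⟨b, hqb⟩ : ∃ b, q = 10 * b + 2 :=
    ⟨q / 10, by have : q % 10 = 2 := hq10; omega⟩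
  have hb : 0 < b := by omega
  have he : 0 < e := by
    rcases Nat.eq_zero_or_pos e with rfl | h
    · rw [pow_zero] at hq
      omega
    · exact h
  have hlam2 : lam ≤ 2 * b + 1 := by
    have h : (lam : ℚ) ≤ ((2 * b + 1 : ℕ) : ℚ) := by
      rw [hqb] at hlam'
      push_cast at hlam' ⊢
      linarith
    exact_mod_cast h
  have hr' : r = 10 * b + 3 := by omega
  have hn' : n = 20 * b ^ 2 + 8 * b + 1 := by
    have h : q ^ 2 + 1 = 5 * (20 * b ^ 2 + 8 * b + 1) := by rw [hqb]; ring
    omega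
  have hs' : s = (5 * b + 1) * (10 * b + 1) := by
    have h : q ^ 2 = 2 * ((5 * b + 1) * (10 * b + 1)) + q := by rw [hqb]; ring
    omega
  have h3b : 3 * (q - 2) / 10 = 3 * b := by omega
  have h1b : (q - 2) / 10 = b := by omega
  obtain ⟨m, hm⟩ : ∃ m, m = 3 * b - 1 + lam := ⟨_, rfl⟩
  -- The bound `λ ≤ (q + 3) / 5 = 2b + 1` gives `m ≤ 5b`, as the lattice argument needs; `λ ≥ 1`
  -- gives `3b ≤ m`, so all four solutions lie in the interval.
  have hmu : m ≤ 5 * b := by omega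
  have hml : 3 * b ≤ m := by omega
  -- With `m ≤ 5b` this yields `4m + 5 ≤ n`, used for `d ≤ (n + 2) / 2` and for the exactness of the
  -- distance.
  have hbn : 20 * b + 5 ≤ n := by rw [hn']; nlinarith
  have hr0 : 0 < r := by omega
  rw [h3b, ← hm, Constacyclic.iUnion_cyclotomicCoset hqb hr' hn' hs'] at hZ
  have : Fact (Nat.Prime 2) := ⟨Nat.prime_two⟩
  have : CharP F 2 := by
    refine charP_of_card_eq_prime_pow (p := 2) (f := e * 2) ?_
    rw [hF, hq, pow_mul]
  rw [h3b, h1b]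
  have hpt : ∀ j : ℕ, (s : ZMod (r * n)) - (r : ZMod (r * n)) * (j : ZMod (r * n)) =
      Constacyclic.pt r n s (-j) := by
    intro j
    rw [Constacyclic.pt]
    push_cast
    ring
  refine ⟨?_, ⟨_, _, rfl, rfl, ?_⟩, ?_⟩
  · rw [hZ]
    exact Constacyclic.exists_isGenerator_definingSet hq hqb hr' hn' hs' hmu (by omega) hF hδ hδα
  · have hne : ∀ t t' : ℤ, t ≠ t' → -(5 * b) ≤ t → t ≤ 5 * b + 1 → -(5 * b) ≤ t' →
        t' ≤ 5 * b + 1 → Constacyclic.pt r n s t ≠ Constacyclic.pt r n s t' :=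
      fun t t' h h1 h2 h3 h4 h5 => h (Constacyclic.pt_injOn hr0 h5 (by omega) (by omega))
    rw [hpt, hpt, Constacyclic.cyclotomicCoset_pt hqb hr' hn' hs',
      Constacyclic.cyclotomicCoset_pt hqb hr' hn' hs']
    refine ⟨?_, ?_, ?_, ?_⟩
    · rw [hZ, Constacyclic.inter_negMul hqb hr' hn' hs' hmu hml]
      congr 3 <;> congr 1 <;> push_cast <;> ring
    · rw [Set.disjoint_left]
      rintro x (rfl | rfl) (h | h) <;> revert h <;> apply hne <;> push_cast <;> omega
    · exact Set.ncard_pair (hne _ _ (by omega) (by omega) (by omega) (by omega) (by omega))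
    · exact Set.ncard_pair (hne _ _ (by omega) (by omega) (by omega) (by omega) (by omega))
  · intro C g _ hg hgZ
    obtain ⟨h1, h2, h3, h4⟩ := Constacyclic.parameters_of_definingSet he hq hb hqb hr' hn' hs' hmu
      hml (by omega) hF hδ hδα hg (hgZ.trans hZ) (by omega)
    have hk : ((n - 4 * m : ℕ) : ℚ) = n - 4 * m := by
      rw [Nat.cast_sub (by omega)]
      push_cast
      rfl
    have hmq : (m : ℚ) = 3 * b - 1 + lam := by
      rw [hm, Nat.cast_add, Nat.cast_sub (by omega)]
      push_cast
      rfl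
    have hdn : ((4 * m + 5 : ℕ) : ℚ) ≤ n := Nat.cast_le.2 (by omega)
    refine ⟨n - 4 * m, 2 * m + 3, ?_, ?_, h2, by omega, h3, h4, ?_, ?_⟩
    · rw [hk, hmq, hqb]
      push_cast
      ring
    · push_cast
      rw [hmq, hqb]
      push_cast
      ring
    · push_cast at hdn ⊢
      linarith
    · rw [hk]
      push_cast
      ring
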